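/- Let $(R,\mathfrak m)$ be a Cohen–Macaulay (Noetherian) local ring of dimension $d$ with $1\le d\le 2$ and infinite residue field, and let $I,J$ be $\mathfrak m$-primary ideals of $R$. For an ideal $K$ put $K^n=R$ whenever $n\le 0$. Let $\mathcal F=\{\mathcal F(r,s)\}_{r,s\in\mathbb Z}$ be a $\mathbb Z^2$-graded $(I,J)$-admissible filtration of ideals of $R$; that is, for all integers $r,s,r',s'$: - $I^rJ^s\subseteq\mathcal F(r,s)$; - $\mathcal F(r,s)\,\mathcal F(r',s')\subseteq\mathcal F(r+r',s+s')$; - $\mathcal F(r',s')\subseteq\mathcal F(r,s)$ if $r'\ge r$ and $s'\ge s$; - $\mathcal F(r,s)=\mathcal F(\max(r,0),\max(s,0))$; and the extended Rees ring $\bigoplus_{r,s\in\mathbb Z}\mathcal F(r,s)t_1^rt_2^s$ is a finite module over $\bigoplus_{r,s\in\mathbb Z}I^rJ^st_1^rt_2^s$. Let $H_{\mathcal F}(r,s)=\lambda(R/\mathcal F(r,s))$, where $\lambda$ denotes length, and let $$P_{\mathcal F}(r,s)=\sum_{\alpha\in\mathbb N^2,\ |\alpha|\le d}(-1)^{d-|\alpha|}\,e_\alpha(\mathcal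 F)\binom{r+\alpha_1-1}{\alpha_1}\binom{s+\alpha_2-1}{\alpha_2},\qquad e_\alpha(\mathcal F)\in\mathbb Z,\quad |\alpha|=\alpha_1+\alpha_2,$$ be the Hilbert polynomial of $\mathcal F$, i.e. the unique polynomial of this form with $P_{\mathcal F}(r,s)=H_{\mathcal F}(r,s)$ for all sufficiently large $r$ and $s$. Then the following statements are equivalent: 1. $e_{(d-1,0)}(\mathcal F)=0$ and $e_{(0,d-1)}(\mathcal F)=0$. 2. $I$ and $J$ are each generated by a system of parameters of $R$, $P_{\mathcal F}(r,s)=H_{\mathcal F}(r,s)$ for all $r,s\in\mathbb N$, and $\mathcal F(r,s)=I^rJ^s$ for all $r,s\in\mathbb Z$. 3. $e_\alpha(\mathcal F)=0$ for all $\alpha\in\mathbb N^2$ with $|\alpha|\le d-1$. -/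

import Mathlib

namespace BigradedHilbert

open IsLocalRing

/-- A Noetherian local ring is Cohen-Macaulay if its depth equals its dimension, i.e. if there is
a regular sequence whose length is the Krull dimension of `R`. (Since `IsRegular` requires
`(x₁, …, xₙ) ≠ R`, such a sequence lies in the maximal ideal.) -/
def IsCohenMacaulayLocal (R : Type*) [CommRing R] [IsLocalRing R] : Prop :=
  IsNoetherianRing R ∧
    ∃ rs : List R, RingTheory.Sequence.IsRegular R rs ∧
      ((rs.length : ℕ∞) : WithBot ℕ∞) = ringKrullDim R

/-- `I` is primary to the maximal ideal of the local ring `R`. -/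
def IsMaximalPrimary {R : Type*} [CommRing R] [IsLocalRing R] (I : Ideal R) : Prop :=
  I.IsPrimary ∧ I.radical = maximalIdeal R

/-- `x₁, …, x_d` is a system of parameters of the local ring `R`: `d = dim R` and
the ideal `(x₁, …, x_d)` is primary to the maximal ideal. -/
def IsSystemOfParameters {R : Type*} [CommRing R] [IsLocalRing R] {d : ℕ} (x : Fin d → R) : Prop :=
  ringKrullDim R = ((d : ℕ∞) : WithBot ℕ∞) ∧ IsMaximalPrimary (Ideal.span (Set.range x))

/-- `I` is a parameter ideal: it is generated by a system of parameters. -/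
def IsParameterIdeal {R : Type*} [CommRing R] [IsLocalRing R] (I : Ideal R) : Prop :=
  ∃ (d : ℕ) (x : Fin d → R), IsSystemOfParameters x ∧ I = Ideal.span (Set.range x)

/-- The power `I ^ n` for an integer `n`, with the convention `I ^ n = R` for `n ≤ 0`. -/
def idealZPow {R : Type*} [CommRing R] (I : Ideal R) (n : ℤ) : Ideal R :=
  I ^ n.toNat

/-- A `ℤ²`-graded `(I, J)`-filtration of ideals of `R`. -/
structure Filtration {R : Type*} [CommRing R] (I J : Ideal R) where
  /-- The ideal `F(r, s)`. -/
  ideal : ℤ → ℤ → Ideal R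
  pow_le : ∀ r s, idealZPow I r * idealZPow J s ≤ ideal r s
  mul_le : ∀ r s r' s', ideal r s * ideal r' s' ≤ ideal (r + r') (s + s')
  anti : ∀ r s r' s', r ≤ r' → s ≤ s' → ideal r' s' ≤ ideal r s

lemma idealZPow_mul_le {R : Type*} [CommRing R] (I : Ideal R) (m n : ℤ) :
    idealZPow I m * idealZPow I n ≤ idealZPow I (m + n) := by
  unfold idealZPow
  rw [← pow_add]
  exact Ideal.pow_le_pow_right (by omega)

lemma idealZPow_anti {R : Type*} [CommRing R] (I : Ideal R) {m n : ℤ} (h : m ≤ n) :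
    idealZPow I n ≤ idealZPow I m :=
  Ideal.pow_le_pow_right (by omega)

/-- The filtration `{I^r J^s}`. -/
def adicFiltration {R : Type*} [CommRing R] (I J : Ideal R) : Filtration I J where
  ideal r s := idealZPow I r * idealZPow J s
  pow_le _ _ := le_rfl
  mul_le r s r' s' := by
    rw [mul_mul_mul_comm]
    exact Ideal.mul_mono (idealZPow_mul_le I r r') (idealZPow_mul_le J s s')
  anti _ _ _ _ hr hs := Ideal.mul_mono (idealZPow_anti I hr) (idealZPow_anti J hs)

/-- The extended Rees ring `⨁ F(r, s) t₁^r t₂^s`, over all integers `r, s`, as a subalgebra of the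
Laurent polynomial ring `R[t₁^{±1}, t₂^{±1}]`. -/
def extendedReesRing {R : Type*} [CommRing R] {I J : Ideal R} (F : Filtration I J) :
    Subalgebra R (AddMonoidAlgebra R (ℤ × ℤ)) where
  carrier := {f | ∀ n : ℤ × ℤ, f.coeff n ∈ F.ideal n.1 n.2}
  mul_mem' {f g} hf hg n := by
    classical
    rw [AddMonoidAlgebra.coeff_mul]
    refine Ideal.sum_mem _ fun a _ => Ideal.sum_mem _ fun b _ => ?_
    dsimp only
    split_ifs with h
    · subst h
      exact F.mul_le _ _ _ _ (Ideal.mul_mem_mul (hf a) (hg b))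
    · exact Ideal.zero_mem _
  add_mem' {f g} hf hg n := by
    simpa using Ideal.add_mem _ (hf n) (hg n)
  algebraMap_mem' c n := by
    classical
    rw [AddMonoidAlgebra.coe_algebraMap]
    simp only [Function.comp_apply, AddMonoidAlgebra.coeff_single, Finsupp.single_apply]
    split_ifs with h
    · subst h
      have h0 := F.pow_le 0 0
      simp only [idealZPow, Int.toNat_zero, pow_zero, Ideal.one_eq_top, Ideal.mul_top] at h0
      exact h0 trivial
    · exact Ideal.zero_mem _

lemma extendedReesRing_adic_le {R : Type*} [CommRing R] {I J : Ideal R} (F : Filtration I J) :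
    extendedReesRing (adicFiltration I J) ≤ extendedReesRing F :=
  fun _ hf n => F.pow_le n.1 n.2 (hf n)

/-- The `(I, J)`-filtration `F` is admissible: `F(r, s) = F(r⁺, s⁺)` for all `r, s`, and the
extended Rees ring of `F` is a finite module over the extended Rees ring of `{I^r J^s}`. -/
structure Filtration.IsAdmissible {R : Type*} [CommRing R] {I J : Ideal R}
    (F : Filtration I J) : Prop where
  eq_posPart : ∀ r s, F.ideal r s = F.ideal (max r 0) (max s 0)
  finite : (Subalgebra.inclusion (extendedReesRing_adic_le F)).Finite

/-- The Hilbert function `H_F(r, s) = λ(R / F(r, s))`. (The length is finite when `R` is Noetherian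
local and `I`, `J` are primary to the maximal ideal.) -/
noncomputable def Filtration.hilbertFunction {R : Type*} [CommRing R] {I J : Ideal R}
    (F : Filtration I J) (r s : ℤ) : ℤ :=
  ((Module.length R (R ⧸ F.ideal r s)).toNat : ℤ)

/-- The value at `(r, s)` of the polynomial of degree at most `d` with coefficients `e_α`:
`∑_{|α| ≤ d} (-1)^(d - |α|) e_α binom(r + α₁ - 1, α₁) binom(s + α₂ - 1, α₂)`,
where `binom(x, k) = x (x - 1) ⋯ (x - k + 1) / k!` for every integer `x`. -/
noncomputable def binomialPolynomial (d : ℕ) (e : ℕ × ℕ → ℤ) (r s : ℤ) : ℤ :=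
  ∑ k ∈ Finset.range (d + 1), ∑ α ∈ Finset.HasAntidiagonal.antidiagonal k,
    (-1) ^ (d - k) * e α *
      Ring.choose (r + α.1 - 1) α.1 * Ring.choose (s + α.2 - 1) α.2

/-- `e` is the family of Hilbert coefficients of `F`, where `d` is the dimension of the ring:
the polynomial with coefficients `e_α`, `|α| ≤ d`, agrees with the Hilbert function for all large
`(r, s)`. Indices with `|α| > d` do not occur in the polynomial and get the value `0`, so that there
is at most one such family. -/
def Filtration.IsHilbertCoeff {R : Type*} [CommRing R] {I J : Ideal R}
    (F : Filtration I J) (d : ℕ) (e : ℕ × ℕ → ℤ) : Prop :=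
  (∀ α : ℕ × ℕ, d < α.1 + α.2 → e α = 0) ∧
    ∃ N : ℤ, ∀ r s : ℤ, N ≤ r → N ≤ s → F.hilbertFunction r s = binomialPolynomial d e r s

open scoped Classical in
/-- The Hilbert coefficients `e_α(F)`, where `d` is the dimension of the ring. (The value `0` in the
absence of a Hilbert polynomial never occurs for admissible filtrations.) -/
noncomputable def Filtration.hilbertCoeff {R : Type*} [CommRing R] {I J : Ideal R}
    (F : Filtration I J) (d : ℕ) : ℕ × ℕ → ℤ :=
  if h : ∃ e : ℕ × ℕ → ℤ, F.IsHilbertCoeff d e then h.choose else 0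

/-- The Hilbert polynomial `P_F`, as a function on `ℤ²`. -/
noncomputable def Filtration.hilbertPolynomial {R : Type*} [CommRing R] {I J : Ideal R}
    (F : Filtration I J) (d : ℕ) (r s : ℤ) : ℤ :=
  binomialPolynomial d (F.hilbertCoeff d) r s

end BigradedHilbert

/-! The content is that e_(d-1,0) = e_(0,d-1) = 0 forces everything else; dimension two reduces to
dimension one modulo a superficial element.

In dimension one there are regular a in I and b in J with F(r+1,s) = aF(r,s) for large r and
F(r,s+1) = bF(r,s) for large s. The gap rλ(R/a) + sλ(R/b) - H(r,s) is nondecreasing in each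
variable, vanishes at the origin, and is eventually constant, equal to e_(0,0). If that constant is
0, the gap vanishes on ℕ², and comparing colengths gives F(r,s) = (a^r b^s). This is
`Filtration.IsAdmissible.exists_hilbertFunction_eq`.

In dimension two a generic a in I is regular and superficial
(`Filtration.IsAdmissible.generic_superficial`), so H(r+1,s) - H(r,s) is, for large r, the Hilbert
function of the image of F in R/a at (r+1,s). The constant of that one-dimensional polynomial is
e_(1,0)(F). If it is zero, F(r,s) lies in I^r J^s + (a) for generic a, and likewise modulo generic b
in J if e_(0,1) = 0. Testing against r such a's and s such b's in general position gives F(r,s) =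
I^r J^s (`mem_pow_mul_of_forall_mem_sup`). The same argument gives (I^(r+1) J^s : a) = I^r J^s
(`colonElem_pow_mul`), so the difference formula holds from the origin on, and H = P with e_(0,0) =
0.

Conversely, if I is a parameter ideal, it is generated by two elements, one of which can be taken to
be a superficial a. Then λ(R/(I^n + a)) = nλ(R/I), and comparison with P along s = 0 gives e_(1,0) =
0 (`Filtration.IsAdmissible.coeff_one_zero_eq_zero`); exchanging I and J gives e_(0,1) = 0, and the
value at the origin gives e_(0,0) = 0. -/

namespace BigradedHilbert

open IsLocalRing

/-! ### Colength and colon ideals. -/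

section Colength

variable {R : Type*} [CommRing R]

/-- The length of `R ⧸ K`, as an integer. -/
noncomputable def colength (K : Ideal R) : ℤ :=
  ((Module.length R (R ⧸ K)).toNat : ℤ)

/-- The colon ideal `(K : a)`. -/
def colonElem (K : Ideal R) (a : R) : Ideal R :=
  Submodule.comap (LinearMap.mulLeft R a) K

lemma mem_colonElem {K : Ideal R} {a x : R} : x ∈ colonElem K a ↔ a * x ∈ K := Iff.rfl

lemma le_colonElem (K : Ideal R) (a : R) : K ≤ colonElem K a :=
  fun _ hx => K.mul_mem_left a hx

/-- Multiplication by a gives the exact sequence 0 → R/(K : a) → R/K → R/(K + a) → 0. -/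
lemma length_quotient_eq_add (K : Ideal R) (a : R) :
    Module.length R (R ⧸ K) =
      Module.length R (R ⧸ colonElem K a) + Module.length R (R ⧸ (K ⊔ Ideal.span {a})) := by
  have hle : colonElem K a ≤ Submodule.comap (LinearMap.mulLeft R a) K := fun _ h => h
  refine Module.length_eq_add_of_exact
    (Submodule.mapQ (colonElem K a) K (LinearMap.mulLeft R a) hle)
    (Submodule.factor (le_sup_left : K ≤ K ⊔ Ideal.span {a})) ?_ ?_ ?_
  · rw [← LinearMap.ker_eq_bot, LinearMap.ker_eq_bot']
    intro m
    induction m using Submodule.Quotient.induction_on with | _ x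
    intro h
    rw [Submodule.mapQ_apply, Submodule.Quotient.mk_eq_zero] at h
    rwa [Submodule.Quotient.mk_eq_zero]
  · exact Submodule.factor_surjective _
  · intro y
    induction y using Submodule.Quotient.induction_on with | _ y
    constructor
    · intro h
      have h' : y ∈ K ⊔ Ideal.span {a} := by
        rw [← Submodule.Quotient.mk_eq_zero]
        exact h
      obtain ⟨k, hk, z, hz, rfl⟩ := Submodule.mem_sup.mp h'
      obtain ⟨w, rfl⟩ := Ideal.mem_span_singleton'.mp hz
      refine ⟨Submodule.Quotient.mk w, ?_⟩
      rw [Submodule.mapQ_apply]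
      refine (Submodule.Quotient.eq _).mpr ?_
      have : LinearMap.mulLeft R a w - (k + w * a) = -k := by
        rw [LinearMap.mulLeft_apply]; ring
      rw [this]
      exact K.neg_mem hk
    · rintro ⟨x, hx⟩
      induction x using Submodule.Quotient.induction_on with | _ x
      rw [Submodule.mapQ_apply] at hx
      rw [← hx]
      change (Submodule.Quotient.mk (a * x) : R ⧸ (K ⊔ Ideal.span {a})) = 0
      rw [Submodule.Quotient.mk_eq_zero]
      exact Ideal.mem_sup_right (Ideal.mem_span_singleton'.mpr ⟨x, mul_comm _ _⟩)

lemma colength_top : colength (⊤ : Ideal R) = 0 := by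
  have : Subsingleton (R ⧸ (⊤ : Ideal R)) := Ideal.Quotient.subsingleton_iff.mpr rfl
  simp [colength]

lemma colength_map_quotient (K : Ideal R) (a : R) :
    colength (K.map (Ideal.Quotient.mk (Ideal.span {a}))) = colength (K ⊔ Ideal.span {a}) := by
  unfold colength
  congr 2
  rw [← Module.length_eq_of_surjective (S := R) (R := R ⧸ Ideal.span {a})
    (M := (R ⧸ Ideal.span {a}) ⧸ K.map (Ideal.Quotient.mk (Ideal.span {a})))
    Ideal.Quotient.mk_surjective, sup_comm]
  exact (DoubleQuot.quotQuotEquivQuotSupₐ R (Ideal.span {a}) K).toLinearEquiv.length_eq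

variable [IsLocalRing R]

/-- `K` contains a power of the maximal ideal. -/
def ContainsMaxPow (K : Ideal R) : Prop := ∃ k : ℕ, maximalIdeal R ^ k ≤ K

lemma ContainsMaxPow.mono {K K' : Ideal R} (h : ContainsMaxPow K) (hK : K ≤ K') :
    ContainsMaxPow K' :=
  h.imp fun _ hk => hk.trans hK

lemma ContainsMaxPow.mul {K K' : Ideal R} (h : ContainsMaxPow K) (h' : ContainsMaxPow K') :
    ContainsMaxPow (K * K') := by
  obtain ⟨k, hk⟩ := h
  obtain ⟨k', hk'⟩ := h'
  exact ⟨k + k', (pow_add _ k k').le.trans (Ideal.mul_mono hk hk')⟩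

lemma ContainsMaxPow.pow {K : Ideal R} (h : ContainsMaxPow K) (n : ℕ) :
    ContainsMaxPow (K ^ n) := by
  obtain ⟨k, hk⟩ := h
  exact ⟨k * n, (pow_mul _ k n).le.trans (Ideal.pow_right_mono hk n)⟩

lemma ContainsMaxPow.map {K : Ideal R} (h : ContainsMaxPow K) {S : Type*} [CommRing S]
    [IsLocalRing S] (f : R →+* S) (hf : Function.Surjective f) : ContainsMaxPow (K.map f) := by
  obtain ⟨k, hk⟩ := h
  refine ⟨k, ?_⟩
  rw [← IsLocalRing.map_maximalIdeal_of_surjective f hf, ← Ideal.map_pow]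
  exact Ideal.map_mono hk

variable [IsNoetherianRing R]

lemma containsMaxPow_of_prime {K : Ideal R} (h : ∀ P : Ideal R, P.IsPrime → K ≤ P →
    P = maximalIdeal R) : ContainsMaxPow K := by
  have hrad : maximalIdeal R ≤ K.radical := by
    rw [Ideal.radical_eq_sInf]
    refine le_sInf fun P hP => ?_
    exact (h P hP.2 hP.1).ge
  obtain ⟨k, hk⟩ := Ideal.exists_pow_le_of_le_radical_of_fg hrad
    (IsNoetherian.noetherian (maximalIdeal R))
  exact ⟨k, hk⟩

/-- A prime of R/K pulls back to a prime containing a power of the maximal ideal, so R/K is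
Artinian. Finiteness matters because `colength` sends infinite length to 0. -/
lemma ContainsMaxPow.length_ne_top {K : Ideal R} (h : ContainsMaxPow K) :
    Module.length R (R ⧸ K) ≠ ⊤ := by
  by_cases hK : K = ⊤
  · subst hK
    have : Subsingleton (R ⧸ (⊤ : Ideal R)) := Ideal.Quotient.subsingleton_iff.mpr rfl
    simp
  have : Nontrivial (R ⧸ K) := Ideal.Quotient.nontrivial_iff.mpr hK
  have : Ring.KrullDimLE 0 (R ⧸ K) := by
    rw [Ring.krullDimLE_zero_iff]
    intro P hP
    obtain ⟨k, hk⟩ := h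
    have hQ : (P.comap (Ideal.Quotient.mk K)).IsPrime := Ideal.comap_isPrime _ _
    have hle : maximalIdeal R ≤ P.comap (Ideal.Quotient.mk K) := by
      refine hQ.le_of_pow_le (n := k) (hk.trans ?_)
      intro x hx
      rw [Ideal.mem_comap, Ideal.Quotient.eq_zero_iff_mem.mpr hx]
      exact P.zero_mem
    have hmax : (P.comap (Ideal.Quotient.mk K)).IsMaximal := by
      rw [← (maximalIdeal.isMaximal R).eq_of_le hQ.ne_top hle]
      exact maximalIdeal.isMaximal R
    have := Ideal.map_eq_top_or_isMaximal_of_surjective (Ideal.Quotient.mk K)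
      Ideal.Quotient.mk_surjective hmax
    rw [Ideal.map_comap_of_surjective _ Ideal.Quotient.mk_surjective] at this
    exact this.resolve_left hP.ne_top
  have : IsArtinianRing (R ⧸ K) := by
    rw [isArtinianRing_iff_isNoetherianRing_krullDimLE_zero]
    exact ⟨inferInstance, this⟩
  rw [Module.length_eq_of_surjective (S := R) (R := R ⧸ K) (M := R ⧸ K)
    Ideal.Quotient.mk_surjective]
  exact Module.length_ne_top

lemma ContainsMaxPow.colength_eq_add {K : Ideal R} (h : ContainsMaxPow K) (a : R) :
    colength K = colength (colonElem K a) + colength (K ⊔ Ideal.span {a}) := by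
  unfold colength
  rw [length_quotient_eq_add K a, ENat.toNat_add, Nat.cast_add]
  · exact (h.mono (le_colonElem K a)).length_ne_top
  · exact (h.mono le_sup_left).length_ne_top

lemma ContainsMaxPow.colength_le {K K' : Ideal R} (h : ContainsMaxPow K) (hK : K ≤ K') :
    colength K' ≤ colength K := by
  unfold colength
  have := Module.length_le_of_surjective (Submodule.factor hK) (Submodule.factor_surjective hK)
  exact_mod_cast ENat.toNat_le_toNat this h.length_ne_top

/-- The kernel of R/K → R/K' has length zero by additivity. -/
lemma ContainsMaxPow.eq_of_colength_le {K K' : Ideal R} (h : ContainsMaxPow K) (hK : K ≤ K')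
    (hc : colength K ≤ colength K') : K = K' := by
  have hadd := Module.length_eq_add_of_exact (LinearMap.ker (Submodule.factor hK)).subtype
    (Submodule.factor hK) (Submodule.subtype_injective _) (Submodule.factor_surjective hK)
    (LinearMap.exact_subtype_ker_map _)
  have h1 := h.length_ne_top
  have h2 := (h.mono hK).length_ne_top
  have h0 : Module.length R (LinearMap.ker (Submodule.factor hK)) = 0 := by
    unfold colength at hc
    generalize Module.length R (LinearMap.ker (Submodule.factor hK)) = x at *
    generalize Module.length R (R ⧸ K) = y at *
    generalize Module.length R (R ⧸ K') = z at *
    lift y to ℕ using h1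
    lift z to ℕ using h2
    have hx : x ≠ ⊤ := by
      rintro rfl
      simp at hadd
    lift x to ℕ using hx
    norm_cast at hadd
    simp only [ENat.toNat_natCast, Nat.cast_le] at hc
    norm_cast
    omega
  rw [Module.length_eq_zero_iff] at h0
  refine le_antisymm hK fun x hx => ?_
  have hx0 : (Submodule.Quotient.mk x : R ⧸ K) ∈ LinearMap.ker (Submodule.factor hK) := by
    rw [LinearMap.mem_ker]
    exact (Submodule.Quotient.mk_eq_zero _).mpr hx
  have := Subsingleton.elim (⟨_, hx0⟩ : LinearMap.ker (Submodule.factor hK)) 0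
  rw [Subtype.ext_iff] at this
  exact (Submodule.Quotient.mk_eq_zero _).mp this

end Colength

/-! ### Generic elements of an ideal. -/

section Generic

variable {R : Type*} [CommRing R]

/-- The property `p` holds for every element of `I` outside a finite union of ideals none of which
contains `I`. -/
def Generic (I : Ideal R) (p : R → Prop) : Prop :=
  ∃ S : Set (Ideal R), S.Finite ∧ (∀ V ∈ S, ¬ I ≤ V) ∧ ∀ a ∈ I, (∀ V ∈ S, a ∉ V) → p a

lemma Generic.mono {I : Ideal R} {p q : R → Prop} (h : Generic I p)
    (hpq : ∀ a ∈ I, p a → q a) : Generic I q := by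
  obtain ⟨S, hS, hV, H⟩ := h
  exact ⟨S, hS, hV, fun a ha h => hpq a ha (H a ha h)⟩

/-- The two exceptional sets are united; this is what allows several conditions to be imposed on one
element. -/
lemma Generic.and {I : Ideal R} {p q : R → Prop} (h : Generic I p) (h' : Generic I q) :
    Generic I (fun a => p a ∧ q a) := by
  obtain ⟨S, hS, hV, H⟩ := h
  obtain ⟨S', hS', hV', H'⟩ := h'
  refine ⟨S ∪ S', hS.union hS', fun V hVm => hVm.elim (hV V) (hV' V), fun a ha h => ?_⟩
  exact ⟨H a ha fun V hm => h V (Or.inl hm), H' a ha fun V hm => h V (Or.inr hm)⟩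

lemma generic_of_forall {I : Ideal R} {p : R → Prop} (h : ∀ a ∈ I, p a) : Generic I p :=
  ⟨∅, Set.finite_empty, by simp, fun a ha _ => h a ha⟩

lemma generic_notMem {I V : Ideal R} (h : ¬ I ≤ V) : Generic I (fun a => a ∉ V) :=
  ⟨{V}, Set.finite_singleton V, by simpa using h, fun _ _ h => h V rfl⟩

lemma generic_forall_list {ι : Type*} {I : Ideal R} {p : ι → R → Prop} (l : List ι)
    (h : ∀ i ∈ l, Generic I (p i)) : Generic I (fun a => ∀ i ∈ l, p i a) := by
  induction l with
  | nil => exact generic_of_forall (by simp)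
  | cons i l ih =>
    refine ((h i (by simp)).and (ih fun j hj => h j (by simp [hj]))).mono fun a _ ha => ?_
    simpa using ha

variable [IsLocalRing R] [Infinite (ResidueField R)]

/-- If the exceptional ideals V covered I, some V ∩ I would have finite index in I. For y in I
outside V, the multiples ry are distinct modulo V when the r have distinct residues, because a unit
times y is not in V. An infinite residue field excludes this. -/
lemma Generic.exists {I : Ideal R} {p : R → Prop} (h : Generic I p) : ∃ a ∈ I, p a := by
  classical
  obtain ⟨S, hS, hV, H⟩ := h
  by_contra! hcon
  have hcov : ⋃ V ∈ hS.toFinset, ((Submodule.comap I.subtype V : Submodule R I) : Set I)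
      = Set.univ := by
    rw [Set.eq_univ_iff_forall]
    rintro ⟨a, ha⟩
    by_contra hn
    refine hcon a ha (H a ha fun V hVm haV => hn ?_)
    simp only [Set.mem_iUnion]
    exact ⟨V, hS.mem_toFinset.mpr hVm, haV⟩
  obtain ⟨V, hVm, hfi⟩ := Submodule.exists_finiteIndex_of_cover hcov
  have hVI := hV V (hS.mem_toFinset.mp hVm)
  rw [SetLike.not_le_iff_exists] at hVI
  obtain ⟨y, hyI, hyV⟩ := hVI
  have hfin : Finite (I ⧸ Submodule.comap I.subtype V) :=
    AddSubgroup.finite_quotient_of_finiteIndex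
  let N := Submodule.comap I.subtype V
  refine not_finite_iff_infinite.mpr ‹Infinite (ResidueField R)› ?_
  let g : R → I ⧸ N := fun r => Submodule.Quotient.mk (r • ⟨y, hyI⟩)
  have hg : ∀ r r', g r = g r' → residue R r = residue R r' := by
    intro r r' hrr
    rw [← sub_eq_zero, ← map_sub, residue_eq_zero_iff]
    by_contra hu
    rw [mem_maximalIdeal, mem_nonunits_iff, not_not] at hu
    have h1 : (r - r') * y ∈ V := by
      have := (Submodule.Quotient.eq _).mp hrr
      rw [← sub_smul] at this
      exact this
    exact hyV ((Ideal.unit_mul_mem_iff_mem V hu).mp h1)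
  let σ : ResidueField R → R := Function.surjInv (residue_surjective (R := R))
  refine Finite.of_injective (fun k => g (σ k)) fun k k' hk => ?_
  have := hg _ _ hk
  simpa only [σ, Function.surjInv_eq] using this

end Generic

/-! ### Positive depth, regular elements and primary ideals. -/

section Depth

variable {R : Type*} [CommRing R] [IsLocalRing R]

/-- The maximal ideal is not an associated prime of `R ⧸ K`. -/
def DepthPos (K : Ideal R) : Prop :=
  ∀ z, (∀ u ∈ maximalIdeal R, u * z ∈ K) → z ∈ K

/-- Factors of the maximal ideal are removed one at a time from the power contained in N. -/
lemma DepthPos.mem_of_containsMaxPow {K N : Ideal R} (h : DepthPos K) (hN : ContainsMaxPow N)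
    {z : R} (hz : ∀ u ∈ N, u * z ∈ K) : z ∈ K := by
  obtain ⟨k, hk⟩ := hN
  replace hz : ∀ u ∈ maximalIdeal R ^ k, u * z ∈ K := fun u hu => hz u (hk hu)
  clear hk
  induction k with
  | zero => simpa using hz 1 (by simp)
  | succ k ih =>
    refine ih fun u hu => h _ fun v hv => ?_
    rw [← mul_assoc]
    exact hz _ (pow_succ' (maximalIdeal R) k ▸ Ideal.mul_mem_mul hv hu)

lemma DepthPos.not_containsMaxPow {K : Ideal R} (h : DepthPos K) (hK : K ≠ ⊤) :
    ¬ ContainsMaxPow K := fun hc =>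
  hK ((Ideal.eq_top_iff_one K).mpr (h.mem_of_containsMaxPow hc fun _ hu => K.mul_mem_right _ hu))

/-- If `a` and `c` generate an ideal primary to the maximal ideal and `R ⧸ c` has positive depth,
then `a` is regular on `R ⧸ c`. -/
lemma DepthPos.mem_of_mul_mem {a : R} {K : Ideal R} (h : DepthPos K)
    (hac : ContainsMaxPow (Ideal.span {a} ⊔ K)) {z : R} (hz : a * z ∈ K) : z ∈ K := by
  refine h.mem_of_containsMaxPow hac fun u hu => ?_
  obtain ⟨v, hv, w, hw, rfl⟩ := Submodule.mem_sup.mp hu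
  obtain ⟨t, rfl⟩ := Ideal.mem_span_singleton'.mp hv
  rw [add_mul, mul_assoc]
  exact K.add_mem (K.mul_mem_left _ hz) (K.mul_mem_right _ hw)

/-- Depth at least two passes from one regular element to another: if `R ⧸ x` has positive depth,
so does `R ⧸ a`. -/
lemma DepthPos.of_span_singleton {x a : R} (hx : x ∈ nonZeroDivisors R)
    (ha : a ∈ nonZeroDivisors R) (hxm : x ∈ maximalIdeal R)
    (h : DepthPos (Ideal.span {x})) : DepthPos (Ideal.span {a}) := by
  intro z hz
  -- The relation wa = xz turns a socle element z modulo a into a socle element w modulo x.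
  obtain ⟨w, hw⟩ := Ideal.mem_span_singleton'.mp (hz x hxm)
  have hwx : w ∈ Ideal.span {x} := by
    refine h w fun u hu => ?_
    obtain ⟨t, ht⟩ := Ideal.mem_span_singleton'.mp (hz u hu)
    refine Ideal.mem_span_singleton'.mpr ⟨t, ?_⟩
    refine mul_cancel_right_mem_nonZeroDivisors ha |>.mp ?_
    linear_combination x * ht - u * hw
  obtain ⟨v, rfl⟩ := Ideal.mem_span_singleton'.mp hwx
  refine Ideal.mem_span_singleton'.mpr ⟨v, ?_⟩
  refine mul_cancel_left_mem_nonZeroDivisors hx |>.mp ?_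
  linear_combination hw

lemma DepthPos.quotient {K : Ideal R} [IsLocalRing (R ⧸ K)] (h : DepthPos K) :
    DepthPos (⊥ : Ideal (R ⧸ K)) := by
  intro z hz
  obtain ⟨z, rfl⟩ := Ideal.Quotient.mk_surjective z
  rw [Ideal.mem_bot, Ideal.Quotient.eq_zero_iff_mem]
  refine h z fun u hu => ?_
  rw [← Ideal.Quotient.eq_zero_iff_mem, map_mul, ← Ideal.mem_bot]
  refine hz _ ?_
  rw [← IsLocalRing.map_maximalIdeal_of_surjective (Ideal.Quotient.mk K)
    Ideal.Quotient.mk_surjective]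
  exact Ideal.mem_map_of_mem _ hu

/-- The exceptional ideals are the associated primes of R. One containing I would contain the
maximal ideal, contrary to positive depth. -/
lemma generic_mem_nonZeroDivisors [IsNoetherianRing R] (h : DepthPos (⊥ : Ideal R)) {I : Ideal R}
    (hI : ContainsMaxPow I) : Generic I (fun a => a ∈ nonZeroDivisors R) := by
  refine ⟨associatedPrimes R R, associatedPrimes.finite R R, ?_, ?_⟩
  · intro P hP hle
    obtain ⟨hPp, z, hz⟩ := (AssociatedPrimes.mem_iff.trans isAssociatedPrime_iff).mp hP
    obtain ⟨k, hk⟩ := hI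
    have hmP : maximalIdeal R ≤ P := hPp.le_of_pow_le (hk.trans hle)
    have hz0 : z ∈ (⊥ : Ideal R) := by
      refine h z fun u hu => ?_
      have := hmP hu
      rw [hz, Submodule.mem_colon_singleton] at this
      simpa using this
    rw [Ideal.mem_bot] at hz0
    subst hz0
    refine hPp.ne_top ?_
    rw [hz, Ideal.eq_top_iff_one, Submodule.mem_colon_singleton]
    simp
  · intro a _ ha
    by_contra hn
    have : a ∈ (nonZeroDivisors R : Set R)ᶜ := hn
    rw [← biUnion_associatedPrimes_eq_compl_nonZeroDivisors] at this
    simp only [Set.mem_iUnion] at this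
    obtain ⟨P, hP, haP⟩ := this
    exact ha P hP haP

/-- In a ring of dimension at most one, a regular element generates an ideal containing a power of
the maximal ideal. -/
lemma containsMaxPow_span_singleton [IsNoetherianRing R] (hd : ringKrullDim R ≤ 1) {a : R}
    (ha : a ∈ nonZeroDivisors R) : ContainsMaxPow (Ideal.span {a}) := by
  refine containsMaxPow_of_prime fun P hP haP => ?_
  have h1 := (ringKrullDim_quotient_succ_le_of_nonZeroDivisor ha).trans hd
  have h2 : ringKrullDim (R ⧸ Ideal.span {a}) ≤ 0 := by
    generalize ringKrullDim (R ⧸ Ideal.span {a}) = x at h1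
    induction x with
    | bot => exact bot_le
    | coe x =>
      induction x with
      | top => exact absurd h1 (by decide)
      | coe n =>
        norm_cast at h1 ⊢
        omega
  have h3 : Ring.KrullDimLE 0 (R ⧸ Ideal.span {a}) := by
    rw [Ring.krullDimLE_iff]
    exact_mod_cast h2
  have hker : RingHom.ker (Ideal.Quotient.mk (Ideal.span {a})) ≤ P := by
    rwa [Ideal.mk_ker]
  have hP' := Ideal.map_isPrime_of_surjective (f := Ideal.Quotient.mk (Ideal.span {a}))
    Ideal.Quotient.mk_surjective hker
  have hmax := Ring.krullDimLE_zero_iff.mp h3 _ hP'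
  have := Ideal.comap_isMaximal_of_surjective (Ideal.Quotient.mk (Ideal.span {a}))
    Ideal.Quotient.mk_surjective (K := P.map (Ideal.Quotient.mk (Ideal.span {a})))
  rw [Ideal.comap_map_of_surjective _ Ideal.Quotient.mk_surjective,
    ← RingHom.ker_eq_comap_bot, sup_eq_left.mpr hker] at this
  exact IsLocalRing.eq_maximalIdeal this

lemma containsMaxPow_of_isMaximalPrimary [IsNoetherianRing R] {I : Ideal R}
    (hI : IsMaximalPrimary I) : ContainsMaxPow I := by
  obtain ⟨k, hk⟩ := Ideal.exists_pow_le_of_le_radical_of_fg hI.2.ge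
    (IsNoetherian.noetherian (maximalIdeal R))
  exact ⟨k, hk⟩

lemma IsMaximalPrimary.le_maximalIdeal {I : Ideal R} (hI : IsMaximalPrimary I) :
    I ≤ maximalIdeal R :=
  hI.2 ▸ Ideal.le_radical

lemma infinite_residueField_quotient [Infinite (ResidueField R)] (K : Ideal R)
    [IsLocalRing (R ⧸ K)] : Infinite (ResidueField (R ⧸ K)) := by
  have : IsLocalHom (Ideal.Quotient.mk K) :=
    IsLocalHom.of_surjective _ Ideal.Quotient.mk_surjective
  exact Infinite.of_injective _ (ResidueField.map (Ideal.Quotient.mk K)).injective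

end Depth

/-! ### Multiplication by generic elements on finite modules. -/

section FilterRegular

variable {A : Type*} [CommRing A] [IsNoetherianRing A]

/-- If `z ∈ T` avoids finitely many primes not containing `T`, then a power of `T` annihilates the
kernel of multiplication by `z` on a finite module. -/
lemma exists_finite_forall_pow_smul_eq_zero (M : Type*) [AddCommGroup M] [Module A M]
    [Module.Finite A M] (T : Ideal A) :
    ∃ S : Set (Ideal A), S.Finite ∧ (∀ P ∈ S, ¬ T ≤ P) ∧ ∀ z ∈ T, (∀ P ∈ S, z ∉ P) →
      ∃ k : ℕ, ∀ m : M, z • m = 0 → ∀ t ∈ T ^ k, t • m = 0 := by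
  refine ⟨{P ∈ associatedPrimes A M | ¬ T ≤ P}, (associatedPrimes.finite A M).subset
    (Set.sep_subset _ _), fun P hP => hP.2, fun z _ hz => ?_⟩
  let K : Submodule A M := LinearMap.ker (LinearMap.lsmul A M z)
  -- A minimal prime of ann K is associated to M and contains z; since z avoids the associated
  -- primes not containing T, this prime contains T.
  have hrad : T ≤ (Module.annihilator A K).radical := by
    rw [← Ideal.sInf_minimalPrimes]
    refine le_sInf fun P hP => ?_
    have hPK := Module.associatedPrimes.minimalPrimes_annihilator_subset_associatedPrimes A K hP
    have hPM := associatedPrimes.subset_of_injective K.injective_subtype hPK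
    by_contra hTP
    refine hz P ⟨hPM, hTP⟩ (hPK.annihilator_le (Submodule.mem_annihilator.mpr ?_))
    rintro ⟨m, hm⟩ _
    exact Subtype.ext hm
  obtain ⟨k, hk⟩ := Ideal.exists_pow_le_of_le_radical_of_fg hrad (IsNoetherian.noetherian T)
  refine ⟨k, fun m hm t ht => ?_⟩
  exact congrArg Subtype.val (Module.mem_annihilator.mp (hk ht) ⟨m, hm⟩)

/-- A version of `exists_finite_forall_pow_smul_eq_zero` for the quotients `M ⧸ u ^ n M`, uniform
in `n`. -/
lemma exists_finite_forall_pow_smul_mem (M : Type*) [AddCommGroup M] [Module A M]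
    [Module.Finite A M] (T : Ideal A) (u : A) (hu : ∀ m : M, u • m = 0 → m = 0) :
    ∃ S : Set (Ideal A), S.Finite ∧ (∀ P ∈ S, ¬ T ≤ P) ∧ ∀ z ∈ T, (∀ P ∈ S, z ∉ P) →
      ∀ n : ℕ, ∃ k : ℕ, ∀ m m' : M, z • m = u ^ n • m' → ∀ t ∈ T ^ k, ∃ m'' : M,
        t • m = u ^ n • m'' := by
  obtain ⟨S, hS, hT, H⟩ := exists_finite_forall_pow_smul_eq_zero
    (M ⧸ LinearMap.range (LinearMap.lsmul A M u)) T
  refine ⟨S, hS, hT, fun z hzT hz n => ?_⟩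
  obtain ⟨k, hk⟩ := H z hzT hz
  have hinj : ∀ (n : ℕ) (m m' : M), u ^ n • m = u ^ n • m' → m = m' := by
    intro n
    induction n with
    | zero => intro m m' h; simpa using h
    | succ n ih =>
      intro m m' h
      refine ih m m' (sub_eq_zero.mp (hu _ ?_))
      rw [smul_sub, smul_smul, smul_smul, ← pow_succ', h, sub_self]
  induction n with
  | zero => exact ⟨0, fun m _ _ t _ => ⟨t • m, by simp⟩⟩
  | succ n ih =>
    obtain ⟨l, hl⟩ := ih
    refine ⟨k + l, fun m m' h t ht => ?_⟩
    rw [pow_add] at ht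
    induction ht using Submodule.mul_induction_on' with
    | mem_mul_mem t ht t' ht' =>
      -- The power T^l from the inductive hypothesis moves m into u^n M; after cancelling u^n, T^k
      -- supplies the last factor u through M/uM. The exceptional primes thus depend on M/uM only,
      -- not on n.
      obtain ⟨y, hy⟩ := hl m (u • m') (by rw [h, smul_smul, pow_succ]) t' ht'
      have hzy : z • y = u • (t' • m') := by
        refine hinj n _ _ ?_
        rw [smul_comm, ← hy, smul_comm, h, smul_smul, smul_smul, smul_smul, pow_succ]
        congr 1
        ring
      have h0 : z • (Submodule.Quotient.mk y :
          M ⧸ LinearMap.range (LinearMap.lsmul A M u)) = 0 := by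
        rw [← Submodule.Quotient.mk_smul, Submodule.Quotient.mk_eq_zero, hzy]
        exact ⟨t' • m', rfl⟩
      have h1 := hk _ h0 t ht
      rw [← Submodule.Quotient.mk_smul, Submodule.Quotient.mk_eq_zero] at h1
      obtain ⟨w, hw⟩ := h1
      refine ⟨w, ?_⟩
      change u • w = t • y at hw
      rw [mul_smul, hy, smul_comm, ← hw, smul_smul, pow_succ]
    | add t _ t' _ h1 h2 =>
      obtain ⟨w, hw⟩ := h1
      obtain ⟨w', hw'⟩ := h2
      exact ⟨w + w', by rw [add_smul, hw, hw', smul_add]⟩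

end FilterRegular

/-! ### Extended Rees rings and superficial elements. -/

section Rees

variable {R : Type*} [CommRing R] {I J : Ideal R}

local notation "Laurent" => AddMonoidAlgebra R (ℤ × ℤ)

/-- The extended Rees ring of `{I ^ r J ^ s}`. -/
abbrev reesRing (I J : Ideal R) : Subalgebra R (AddMonoidAlgebra R (ℤ × ℤ)) :=
  extendedReesRing (adicFiltration I J)

lemma single_mem_extendedReesRing {F : Filtration I J} {n : ℤ × ℤ} {c : R}
    (h : c ∈ F.ideal n.1 n.2) : AddMonoidAlgebra.single n c ∈ extendedReesRing F := by
  classical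
  intro m
  rw [AddMonoidAlgebra.coeff_single, Finsupp.single_apply]
  split_ifs with hm
  · exact hm ▸ h
  · exact Ideal.zero_mem _

lemma single_mem_extendedReesRing_iff {F : Filtration I J} {r s : ℤ} {c : R} :
    AddMonoidAlgebra.single (r, s) c ∈ extendedReesRing F ↔ c ∈ F.ideal r s := by
  refine ⟨fun h => ?_, fun h => single_mem_extendedReesRing h⟩
  simpa using h (r, s)

lemma Filtration.ideal_eq_top (F : Filtration I J) {r s : ℤ} (hr : r ≤ 0) (hs : s ≤ 0) :
    F.ideal r s = ⊤ := by
  refine top_le_iff.mp (le_trans ?_ (F.pow_le r s))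
  simp [idealZPow, Int.toNat_of_nonpos hr, Int.toNat_of_nonpos hs]

/-- The ideal of coefficients of monomials of degree `n` in an `R`-submodule. -/
noncomputable def monomialIdeal (B : Submodule R Laurent) (n : ℤ × ℤ) : Ideal R where
  carrier := {c | AddMonoidAlgebra.single n c ∈ B}
  add_mem' {a b} ha hb := by
    simp only [Set.mem_ofPred_eq, AddMonoidAlgebra.single_add] at *
    exact B.add_mem ha hb
  zero_mem' := by simp
  smul_mem' c x hx := by
    simp only [Set.mem_ofPred_eq, smul_eq_mul] at *
    rw [← AddMonoidAlgebra.smul_single']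
    exact B.smul_mem c hx

lemma mem_monomialIdeal {B : Submodule R Laurent} {n : ℤ × ℤ} {c : R} :
    c ∈ monomialIdeal B n ↔ AddMonoidAlgebra.single n c ∈ B := Iff.rfl

lemma monomialIdeal_mul_le (B : Subalgebra R Laurent) (m n : ℤ × ℤ) :
    monomialIdeal (Subalgebra.toSubmodule B) m * monomialIdeal (Subalgebra.toSubmodule B) n ≤
      monomialIdeal (Subalgebra.toSubmodule B) (m + n) := by
  rw [Ideal.mul_le]
  intro a ha b hb
  rw [mem_monomialIdeal, ← AddMonoidAlgebra.single_mul_single]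
  exact B.mul_mem ha hb

lemma pow_le_monomialIdeal (B : Subalgebra R Laurent) {K : Ideal R} {m : ℤ × ℤ}
    (h : K ≤ monomialIdeal (Subalgebra.toSubmodule B) m) (k : ℕ) :
    K ^ k ≤ monomialIdeal (Subalgebra.toSubmodule B) (k • m) := by
  induction k with
  | zero =>
    intro c _
    rw [zero_smul]
    exact B.algebraMap_mem c
  | succ k ih =>
    rw [pow_succ, succ_nsmul]
    exact (Ideal.mul_mono ih h).trans (monomialIdeal_mul_le B _ _)

lemma idealZPow_le_monomialIdeal (B : Subalgebra R Laurent) {K : Ideal R} {m : ℤ × ℤ}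
    (h : K ≤ monomialIdeal (Subalgebra.toSubmodule B) m)
    (h' : AddMonoidAlgebra.single (-m) (1 : R) ∈ B) (k : ℤ) :
    idealZPow K k ≤ monomialIdeal (Subalgebra.toSubmodule B) (k • m) := by
  obtain ⟨n, rfl | rfl⟩ := k.eq_nat_or_neg
  · simpa [idealZPow] using pow_le_monomialIdeal B h n
  · have h1 : (⊤ : Ideal R) ≤ monomialIdeal (Subalgebra.toSubmodule B) (-m) :=
      top_le_iff.mpr ((Ideal.eq_top_iff_one _).mpr h')
    have := pow_le_monomialIdeal B h1 n
    rw [Ideal.top_pow, smul_neg] at this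
    rw [neg_smul, natCast_zsmul]
    exact le_top.trans this

/-- It is generated over R by t₁⁻¹, t₂⁻¹ and the finitely many monomials at₁, bt₂ with a, b running
over generators of I, J. -/
instance [IsNoetherianRing R] : IsNoetherianRing (reesRing I J) := by
  classical
  obtain ⟨G, hG⟩ := IsNoetherian.noetherian I
  obtain ⟨G', hG'⟩ := IsNoetherian.noetherian J
  let S : Finset Laurent := (G.image (AddMonoidAlgebra.single (1, 0)) ∪
    G'.image (AddMonoidAlgebra.single (0, 1))) ∪
    {AddMonoidAlgebra.single (-1, 0) 1, AddMonoidAlgebra.single (0, -1) 1}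
  have hSle : Algebra.adjoin R (S : Set Laurent) ≤ reesRing I J := by
    rw [Algebra.adjoin_le_iff]
    intro f hf
    simp only [S, Finset.coe_union, Finset.coe_image, Finset.coe_insert, Finset.coe_singleton,
      Set.mem_union, Set.mem_image, Set.mem_insert_iff, Set.mem_singleton_iff] at hf
    rcases hf with (⟨c, hc, rfl⟩ | ⟨c, hc, rfl⟩) | rfl | rfl <;>
      apply single_mem_extendedReesRing <;> simp only [adicFiltration, idealZPow]
    · simpa using hG ▸ Submodule.subset_span hc
    · simpa using hG' ▸ Submodule.subset_span hc
    · simp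
    · simp
  set B := Algebra.adjoin R (S : Set Laurent) with hB
  have hSB : ∀ f ∈ S, f ∈ B := fun f hf => Algebra.subset_adjoin hf
  have hI : I ≤ monomialIdeal (Subalgebra.toSubmodule B) (1, 0) := by
    rw [← hG]
    refine Submodule.span_le.mpr fun c hc => hSB _ ?_
    simp only [S, Finset.mem_union, Finset.mem_image]
    exact Or.inl (Or.inl ⟨c, hc, rfl⟩)
  have hJ : J ≤ monomialIdeal (Subalgebra.toSubmodule B) (0, 1) := by
    rw [← hG']
    refine Submodule.span_le.mpr fun c hc => hSB _ ?_
    simp only [S, Finset.mem_union, Finset.mem_image]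
    exact Or.inl (Or.inr ⟨c, hc, rfl⟩)
  have h1 : AddMonoidAlgebra.single (-(1, 0)) (1 : R) ∈ B := hSB _ (by simp [S])
  have h2 : AddMonoidAlgebra.single (-(0, 1)) (1 : R) ∈ B := hSB _ (by simp [S])
  have hle : reesRing I J ≤ B := by
    intro f hf
    rw [← AddMonoidAlgebra.sum_coeff_single f]
    refine Subalgebra.sum_mem _ fun n _ => ?_
    have := (Ideal.mul_mono (idealZPow_le_monomialIdeal B hI h1 n.1)
      (idealZPow_le_monomialIdeal B hJ h2 n.2)).trans (monomialIdeal_mul_le B _ _) (hf n)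
    rw [mem_monomialIdeal] at this
    simpa using this
  have hfg : (reesRing I J).FG := ⟨S, le_antisymm hSle hle⟩
  have : Algebra.FiniteType R (reesRing I J) := (reesRing I J).fg_iff_finiteType.mp hfg
  exact Algebra.FiniteType.isNoetherianRing R _

/-- The extended Rees ring of `F` as a module over that of `{I ^ r J ^ s}`. -/
noncomputable def reesModule (F : Filtration I J) : Submodule (reesRing I J) Laurent where
  carrier := extendedReesRing F
  add_mem' ha hb := (extendedReesRing F).add_mem ha hb
  zero_mem' := (extendedReesRing F).zero_mem
  smul_mem' c _ hx := (extendedReesRing F).mul_mem (extendedReesRing_adic_le F c.2) hx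

lemma Filtration.IsAdmissible.reesModule_fg {F : Filtration I J} (hF : F.IsAdmissible) :
    (reesModule F).FG := by
  let := (Subalgebra.inclusion (extendedReesRing_adic_le F)).toRingHom.toAlgebra
  have : Module.Finite (reesRing I J) (extendedReesRing F) := hF.finite
  let ψ : extendedReesRing F →ₗ[reesRing I J] Laurent :=
    { toFun := Subtype.val
      map_add' := fun _ _ => rfl
      map_smul' := fun _ _ => rfl }
  have h := Submodule.FG.map ψ (Module.finite_def.mp this)
  convert h
  ext f
  simp only [Submodule.map_top, LinearMap.mem_range]
  exact ⟨fun hf => ⟨⟨f, hf⟩, rfl⟩, fun ⟨g, hg⟩ => hg ▸ g.2⟩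

/-- A homogeneous finitely generated submodule of the Laurent polynomial ring is generated in
bounded degrees. -/
lemma exists_mem_span_of_fg {C : Submodule (reesRing I J) Laurent} (hC : C.FG)
    (hom : ∀ f ∈ C, ∀ n, AddMonoidAlgebra.single n (f.coeff n) ∈ C) :
    ∃ N : ℕ, ∀ (r s : ℤ) (x : R), AddMonoidAlgebra.single (r, s) x ∈ C →
      x ∈ Ideal.span {z | ∃ (p q : ℤ) (c y : R), p ≤ N ∧ q ≤ N ∧
        c ∈ (adicFiltration I J).ideal (r - p) (s - q) ∧ AddMonoidAlgebra.single (p, q) y ∈ C ∧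
        z = c * y} := by
  classical
  obtain ⟨S, hS⟩ := hC
  let D : Finset (ℤ × ℤ) := S.biUnion fun f => f.coeff.support
  -- N bounds all degrees in the supports of the finitely many generators; homogeneity of C lets
  -- each generator be split into its monomials.
  let N : ℕ := D.sup fun n => n.1.toNat ⊔ n.2.toNat
  have hN : ∀ f ∈ S, ∀ n, f.coeff n ≠ 0 → n.1 ≤ N ∧ n.2 ≤ N := by
    intro f hf n hn
    have hnD : n ∈ D := Finset.mem_biUnion.mpr ⟨f, hf, Finsupp.mem_support_iff.mpr hn⟩
    have := Finset.le_sup (f := fun n : ℤ × ℤ => n.1.toNat ⊔ n.2.toNat) hnD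
    change n.1.toNat ⊔ n.2.toNat ≤ N at this
    have := sup_le_iff.mp this
    omega
  refine ⟨N, fun r s x hx => ?_⟩
  let W : ℤ × ℤ → Ideal R := fun n => Ideal.span {z | ∃ (p q : ℤ) (c y : R), p ≤ N ∧ q ≤ N ∧
        c ∈ (adicFiltration I J).ideal (n.1 - p) (n.2 - q) ∧
        AddMonoidAlgebra.single (p, q) y ∈ C ∧ z = c * y}
  suffices H : ∀ f ∈ C, ∀ n, f.coeff n ∈ W n by
    have := H _ hx (r, s)
    rwa [AddMonoidAlgebra.coeff_single, Finsupp.single_eq_same] at this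
  intro f hf
  have hfC := hf
  rw [← hS] at hf
  clear hfC
  induction hf using Submodule.span_induction with
  | mem f hf =>
    intro n
    by_cases h0 : f.coeff n = 0
    · rw [h0]; exact Ideal.zero_mem _
    · refine Ideal.subset_span ⟨n.1, n.2, 1, f.coeff n, (hN f hf n h0).1, (hN f hf n h0).2, ?_,
        hom f (hS ▸ Submodule.subset_span hf) n, (one_mul _).symm⟩
      simp [adicFiltration, idealZPow]
  | zero => intro n; exact Ideal.zero_mem _
  | add f g _ _ hf hg =>
    intro n
    exact Ideal.add_mem _ (hf n) (hg n)
  | smul a f _ hf =>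
    intro n
    change (a.1 * f).coeff n ∈ W n
    rw [AddMonoidAlgebra.coeff_mul]
    refine Ideal.sum_mem _ fun m _ => Ideal.sum_mem _ fun m' _ => ?_
    dsimp only
    split_ifs with h
    · subst h
      have ha := a.2 m
      have hle : W m' ≤ Submodule.comap (LinearMap.mulLeft R (a.1.coeff m)) (W (m + m')) := by
        refine Ideal.span_le.mpr ?_
        rintro z ⟨p, q, c, y, hp, hq, hc, hy, rfl⟩
        refine Ideal.subset_span ⟨p, q, a.1.coeff m * c, y, hp, hq, ?_, hy, ?_⟩
        · have := (adicFiltration I J).mul_le _ _ _ _ (Ideal.mul_mem_mul ha hc)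
          convert this using 2 <;> simp [add_sub_assoc]
        · simp [mul_assoc]
      exact hle (hf m')
    · exact Ideal.zero_mem _

lemma single_coeff_mem_reesModule {F : Filtration I J} {f : Laurent} (hf : f ∈ reesModule F)
    (n : ℤ × ℤ) : AddMonoidAlgebra.single n (f.coeff n) ∈ reesModule F :=
  single_mem_extendedReesRing (hf n)

lemma adicFiltration_ideal_le (r s : ℤ) : (adicFiltration I J).ideal r s ≤ idealZPow I r :=
  Ideal.mul_le_left

/-- An admissible filtration is eventually contained in the powers of `I`. -/
lemma Filtration.IsAdmissible.exists_le_idealZPow {F : Filtration I J} (hF : F.IsAdmissible) :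
    ∃ N : ℕ, ∀ r s : ℤ, F.ideal r s ≤ idealZPow I (r - N) := by
  obtain ⟨N, hN⟩ := exists_mem_span_of_fg hF.reesModule_fg
    fun f hf n => single_coeff_mem_reesModule hf n
  refine ⟨N, fun r s x hx => ?_⟩
  have hxN := hN r s x (single_mem_extendedReesRing (n := (r, s)) hx)
  refine (Ideal.span_le (I := idealZPow I (r - N))).mpr ?_ hxN
  rintro z ⟨p, q, c, y, hp, _, hc, _, rfl⟩
  have h1 := idealZPow_anti I (sub_le_sub_left hp r) (adicFiltration_ideal_le _ _ hc)
  exact Ideal.mul_mem_right y _ h1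

/-- The monomials `a t₁` with `a ∈ I`. -/
noncomputable def degreeOne (I J : Ideal R) : I →ₗ[R] reesRing I J where
  toFun a := ⟨AddMonoidAlgebra.single (1, 0) a.1,
    single_mem_extendedReesRing (by simp [adicFiltration, idealZPow])⟩
  map_add' a b := Subtype.ext (AddMonoidAlgebra.single_add _ _ _)
  map_smul' c a := Subtype.ext (AddMonoidAlgebra.smul_single' _ _ _).symm

lemma single_mem_span_degreeOne_pow {k : ℕ} {c : R} (hc : c ∈ I ^ k) :
    ∃ t ∈ Ideal.span (Set.range (degreeOne I J)) ^ k,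
      (t : Laurent) = AddMonoidAlgebra.single ((k : ℤ), 0) c := by
  induction k generalizing c with
  | zero =>
    exact ⟨algebraMap R _ c, by simp, rfl⟩
  | succ k ih =>
    rw [pow_succ] at hc
    induction hc using Submodule.mul_induction_on' with
    | mem_mul_mem a ha b hb =>
      obtain ⟨t, ht, hta⟩ := ih ha
      refine ⟨t * degreeOne I J ⟨b, hb⟩, ?_, ?_⟩
      · rw [pow_succ]
        exact Ideal.mul_mem_mul ht (Ideal.subset_span ⟨_, rfl⟩)
      · rw [MulMemClass.coe_mul, hta]
        change _ * AddMonoidAlgebra.single _ _ = _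
        rw [AddMonoidAlgebra.single_mul_single]
        simp
    | add a _ b _ h1 h2 =>
      obtain ⟨t, ht, hta⟩ := h1
      obtain ⟨t', ht', htb⟩ := h2
      refine ⟨t + t', Ideal.add_mem _ ht ht', ?_⟩
      rw [AddMemClass.coe_add, hta, htb, AddMonoidAlgebra.single_add]

/-- Since I^r = I^k I^(r-k), only the first degree matters; this is why superficiality below is
uniform in s. -/
lemma single_mem_span_degreeOne_pow' {k : ℕ} {r s : ℤ} (hr : (k : ℤ) ≤ r) {c : R}
    (hc : c ∈ (adicFiltration I J).ideal r s) :
    ∃ t ∈ Ideal.span (Set.range (degreeOne I J)) ^ k,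
      (t : Laurent) = AddMonoidAlgebra.single (r, s) c := by
  have hc' : c ∈ I ^ k * (adicFiltration I J).ideal (r - k) s := by
    have : idealZPow I r = I ^ k * idealZPow I (r - k) := by
      unfold idealZPow
      rw [← pow_add]
      congr 1
      omega
    change c ∈ I ^ k * (idealZPow I (r - k) * idealZPow J s)
    rw [← mul_assoc, ← this]
    exact hc
  clear hc
  induction hc' using Submodule.mul_induction_on' with
  | mem_mul_mem a ha b hb =>
    obtain ⟨t, ht, hta⟩ := single_mem_span_degreeOne_pow (J := J) ha
    refine ⟨t * ⟨AddMonoidAlgebra.single (r - k, s) b, single_mem_extendedReesRing hb⟩,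
      Ideal.mul_mem_right _ _ ht, ?_⟩
    rw [MulMemClass.coe_mul, hta, AddMonoidAlgebra.single_mul_single]
    simp
  | add a _ b _ h1 h2 =>
    obtain ⟨t, ht, hta⟩ := h1
    obtain ⟨t', ht', htb⟩ := h2
    refine ⟨t + t', Ideal.add_mem _ ht ht', ?_⟩
    rw [AddMemClass.coe_add, hta, htb, AddMonoidAlgebra.single_add]

/-- A generic element of `I` is superficial for `F`. -/
theorem Filtration.IsAdmissible.generic_superficial [IsNoetherianRing R] {F : Filtration I J}
    (hF : F.IsAdmissible) : Generic I fun a => a ∈ nonZeroDivisors R →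
      ∃ N : ℕ, ∀ r s : ℤ, N ≤ r → ∀ x, a * x ∈ F.ideal (r + 1) s → x ∈ F.ideal r s := by
  have hfg := hF.reesModule_fg
  have : Module.Finite (reesRing I J) (reesModule F) := Module.Finite.iff_fg.mpr hfg
  have hNoeth : IsNoetherian (reesRing I J) (reesModule F) :=
    isNoetherian_of_fg_of_noetherian _ hfg
  let T : Ideal (reesRing I J) := Ideal.span (Set.range (degreeOne I J))
  -- Here u = t₁⁻¹t₂⁻¹, a nonzerodivisor lowering both degrees; a high power of it will carry (M :
  -- at₁) into the Rees module M of F.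
  let u : reesRing I J := ⟨AddMonoidAlgebra.single (-1, -1) 1, single_mem_extendedReesRing (by
    simp [adicFiltration, idealZPow])⟩
  have hupow : ∀ n : ℕ, ((u ^ n : reesRing I J) : Laurent) =
      AddMonoidAlgebra.single (-(n : ℤ), -(n : ℤ)) 1 := by
    intro n
    rw [SubmonoidClass.coe_pow]
    change AddMonoidAlgebra.single _ _ ^ n = _
    rw [AddMonoidAlgebra.single_pow]
    simp
  have huinj : ∀ (n : ℕ) (f g : Laurent), u ^ n • f = u ^ n • g → f = g := by
    intro n f g h
    have h' : AddMonoidAlgebra.single (-(n : ℤ), -(n : ℤ)) 1 * f =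
      AddMonoidAlgebra.single (-(n : ℤ), -(n : ℤ)) 1 * g := by rw [← hupow]; exact h
    have h2 := congrArg (AddMonoidAlgebra.single ((n : ℤ), (n : ℤ)) 1 * ·) h'
    have h1 : (AddMonoidAlgebra.single ((n : ℤ), (n : ℤ)) 1 : Laurent) *
        AddMonoidAlgebra.single (-(n : ℤ), -(n : ℤ)) 1 = 1 := by
      rw [AddMonoidAlgebra.single_mul_single, AddMonoidAlgebra.one_def]
      simp
      rfl
    simpa only [← mul_assoc, h1, one_mul] using h2
  obtain ⟨S, hS, hTS, HS⟩ := exists_finite_forall_pow_smul_mem (reesModule F) T u (by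
    intro m hm
    refine Subtype.ext (huinj 1 _ _ ?_)
    rw [pow_one]
    simpa using congrArg Subtype.val hm)
  -- V P consists of the a in I with at₁ in P. It cannot contain I, since T is generated by these
  -- monomials and is not contained in P.
  let V : Ideal (reesRing I J) → Ideal R := fun P =>
    Submodule.map I.subtype (Submodule.comap (degreeOne I J) (P.restrictScalars R))
  refine ⟨V '' S, hS.image V, ?_, ?_⟩
  · rintro _ ⟨P, hP, rfl⟩ hle
    refine hTS P hP (Ideal.span_le.mpr ?_)
    rintro _ ⟨a, rfl⟩
    obtain ⟨b, hb, hba⟩ := hle a.2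
    have : b = a := Subtype.ext hba
    exact this ▸ hb
  intro a ha hav hreg
  let z : reesRing I J := degreeOne I J ⟨a, ha⟩
  have hz : ∀ P ∈ S, z ∉ P := fun P hP hzP =>
    hav _ ⟨P, hP, rfl⟩ ⟨⟨a, ha⟩, hzP, rfl⟩
  have hzcoe : ∀ f : Laurent, z • f = AddMonoidAlgebra.single (1, 0) a * f := fun f => rfl
  have hzcoeff : ∀ (f : Laurent) (n : ℤ × ℤ), (z • f).coeff n = a * f.coeff (n - (1, 0)) := by
    intro f n
    rw [hzcoe, AddMonoidAlgebra.coeff_single_mul_apply, neg_add_eq_sub]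
  let μ : Laurent →ₗ[reesRing I J] Laurent := LinearMap.lsmul (reesRing I J) Laurent z
  -- C is the colon module (M : at₁). It is finitely generated because at₁C embeds in the Noetherian
  -- module M, hence generated in bounded degrees.
  let C := Submodule.comap μ (reesModule F)
  have hμinj : Function.Injective μ := by
    intro f g hfg
    ext n
    have := congrArg (fun h : Laurent => h.coeff (n + (1, 0))) hfg
    change (z • f).coeff _ = (z • g).coeff _ at this
    rw [hzcoeff, hzcoeff, add_sub_cancel_right] at this
    exact (mul_cancel_left_mem_nonZeroDivisors hreg).mp this
  have hCfg : C.FG := by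
    refine Submodule.fg_of_fg_map_injective μ hμinj ?_
    exact Submodule.FG.of_le hfg (Submodule.map_comap_le _ _)
  have hCmem : ∀ (r s : ℤ) (x : R), AddMonoidAlgebra.single (r, s) x ∈ C ↔
      a * x ∈ F.ideal (r + 1) s := by
    intro r s x
    rw [← single_mem_extendedReesRing_iff]
    change AddMonoidAlgebra.single (1, 0) a * _ ∈ extendedReesRing F ↔ _
    rw [AddMonoidAlgebra.single_mul_single, Prod.mk_add_mk, zero_add, add_comm]
  have hChom : ∀ f ∈ C, ∀ n, AddMonoidAlgebra.single n (f.coeff n) ∈ C := by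
    rintro f hf ⟨r, s⟩
    rw [hCmem]
    have := hf (r + 1, s)
    change (z • f).coeff _ ∈ _ at this
    rw [hzcoeff] at this
    simpa using this
  obtain ⟨N, hN⟩ := exists_mem_span_of_fg hCfg hChom
  obtain ⟨k, hk⟩ := HS z (Ideal.subset_span ⟨_, rfl⟩) hz N
  have hkill : ∀ (p q : ℤ) (y : R), AddMonoidAlgebra.single (p, q) y ∈ C → ∀ t ∈ T ^ k,
      t • (AddMonoidAlgebra.single (p, q) y : Laurent) ∈ reesModule F := by
    intro p q y hy t ht
    -- Generators have both degrees at most N, so shifting down by N places them in F of nonpositive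
    -- degree, which is R. Therefore u^N C is contained in M, and the kernel estimate modulo u^N M
    -- yields T^k C ⊆ M.
    have hy' : y ∈ F.ideal (p - N) (q - N) := by
      refine Ideal.span_le.mpr ?_ (hN p q y hy)
      rintro _ ⟨p', q', c, y', hp', hq', hc, _, rfl⟩
      have hy'top : y' ∈ F.ideal (p' - N) (q' - N) := by
        rw [F.ideal_eq_top (by omega) (by omega)]; trivial
      have := F.mul_le _ _ _ _ (Ideal.mul_mem_mul (F.pow_le _ _ hc) hy'top)
      rwa [sub_add_sub_cancel, sub_add_sub_cancel] at this
    have hm : u ^ N • (AddMonoidAlgebra.single (p, q) y : Laurent) ∈ reesModule F := by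
      change ((u ^ N : reesRing I J) : Laurent) * _ ∈ extendedReesRing F
      rw [hupow, AddMonoidAlgebra.single_mul_single, one_mul, Prod.mk_add_mk,
        single_mem_extendedReesRing_iff, neg_add_eq_sub, neg_add_eq_sub]
      exact hy'
    obtain ⟨m'', hm''⟩ := hk ⟨_, hm⟩ ⟨_, hy⟩ (Subtype.ext (smul_comm _ _ _)) t ht
    have h1 := congrArg Subtype.val hm''
    change t • u ^ N • (AddMonoidAlgebra.single (p, q) y : Laurent) = u ^ N • m''.1 at h1
    rw [smul_comm] at h1
    rw [huinj N _ _ h1]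
    exact m''.2
  -- Once r ≥ N + k, each coefficient of a generator of degree p ≤ N has first degree at least k,
  -- hence lies in T^k.
  refine ⟨N + k, fun r s hr x hx => ?_⟩
  refine Ideal.span_le.mpr ?_ (hN r s x ((hCmem r s x).mpr hx))
  rintro _ ⟨p, q, c, y, hp, _, hc, hy, rfl⟩
  obtain ⟨t, ht, htc⟩ := single_mem_span_degreeOne_pow' (k := k) (by push_cast at hr; omega) hc
  have h2 := hkill p q y hy t ht
  change (t : Laurent) * _ ∈ extendedReesRing F at h2
  rw [htc, AddMonoidAlgebra.single_mul_single, Prod.mk_add_mk, sub_add_cancel, sub_add_cancel,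
    single_mem_extendedReesRing_iff] at h2
  exact h2

end Rees

/-! ### Admissibility under exchange of variables and under quotients. -/

section Transfer

variable {R : Type*} [CommRing R] {I J : Ideal R}

/-- Finiteness of extended Rees rings descends along a ring homomorphism between the ambient
Laurent polynomial rings. -/
lemma finite_inclusion_of_ringHom {S : Type*} [CommRing S] {I' J' : Ideal S}
    {F : Filtration I J} {F' : Filtration I' J'}
    (φ : AddMonoidAlgebra R (ℤ × ℤ) →+* AddMonoidAlgebra S (ℤ × ℤ))
    (hA : ∀ f ∈ reesRing I J, φ f ∈ reesRing I' J')
    (hE : ∀ f ∈ extendedReesRing F, φ f ∈ extendedReesRing F')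
    (hsurj : ∀ g ∈ extendedReesRing F', ∃ f ∈ extendedReesRing F, φ f = g)
    (hF : (Subalgebra.inclusion (extendedReesRing_adic_le F)).Finite) :
    (Subalgebra.inclusion (extendedReesRing_adic_le F')).Finite := by
  let φA : reesRing I J →+* reesRing I' J' :=
    { toFun := fun f => ⟨φ f, hA f f.2⟩
      map_one' := Subtype.ext (map_one φ)
      map_mul' := fun f g => Subtype.ext (map_mul φ f.1 g.1)
      map_zero' := Subtype.ext (map_zero φ)
      map_add' := fun f g => Subtype.ext (map_add φ f.1 g.1) }
  let φE : extendedReesRing F →+* extendedReesRing F' :=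
    { toFun := fun f => ⟨φ f, hE f f.2⟩
      map_one' := Subtype.ext (map_one φ)
      map_mul' := fun f g => Subtype.ext (map_mul φ f.1 g.1)
      map_zero' := Subtype.ext (map_zero φ)
      map_add' := fun f g => Subtype.ext (map_add φ f.1 g.1) }
  have hφE : φE.Finite := RingHom.Finite.of_surjective φE fun g => by
    obtain ⟨f, hf, hfg⟩ := hsurj g g.2
    exact ⟨⟨f, hf⟩, Subtype.ext hfg⟩
  have hcomp := hφE.comp hF
  -- The finite composite through the Rees ring of F also factors through the adic Rees ring on the
  -- target side.
  exact RingHom.Finite.of_comp_finite (f := φA)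
    (g := (Subalgebra.inclusion (extendedReesRing_adic_le F')).toRingHom) hcomp

/-- The filtration with the roles of `I` and `J` exchanged. -/
def Filtration.swap (F : Filtration I J) : Filtration J I where
  ideal r s := F.ideal s r
  pow_le r s := (mul_comm _ _).trans_le (F.pow_le s r)
  mul_le r s r' s' := F.mul_le s r s' r'
  anti r s r' s' hr hs := F.anti s r s' r' hs hr

lemma Filtration.IsAdmissible.swap {F : Filtration I J} (hF : F.IsAdmissible) :
    F.swap.IsAdmissible where
  eq_posPart r s := hF.eq_posPart s r
  finite := by
    let φ := AddMonoidAlgebra.domCongr R R (AddEquiv.prodComm (M := ℤ) (N := ℤ))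
    have hcoeff : ∀ (f : AddMonoidAlgebra R (ℤ × ℤ)) (n : ℤ × ℤ),
        (φ f).coeff n = f.coeff n.swap := fun f n => AddMonoidAlgebra.coeff_domCongr ..
    refine finite_inclusion_of_ringHom (φ : _ →+* _) ?_ ?_ ?_ hF.finite
    · intro f hf n
      have := hf n.swap
      change (φ f).coeff n ∈ _
      rw [hcoeff]
      exact (mul_comm (idealZPow I _) (idealZPow J _)).le this
    · intro f hf n
      change (φ f).coeff n ∈ _
      rw [hcoeff]
      exact hf n.swap
    · intro g hg
      refine ⟨φ.symm g, fun n => ?_, φ.apply_symm_apply g⟩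
      have := hcoeff (φ.symm g) n.swap
      rw [φ.apply_symm_apply, Prod.swap_swap] at this
      rw [← this]
      exact hg n.swap

lemma idealZPow_map {S : Type*} [CommRing S] (f : R →+* S) (n : ℤ) :
    idealZPow (I.map f) n = (idealZPow I n).map f :=
  (Ideal.map_pow f I _).symm

/-- The image of a filtration under a ring homomorphism. -/
def Filtration.map {S : Type*} [CommRing S] (F : Filtration I J) (f : R →+* S) :
    Filtration (I.map f) (J.map f) where
  ideal r s := (F.ideal r s).map f
  pow_le r s := by
    rw [idealZPow_map, idealZPow_map, ← Ideal.map_mul]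
    exact Ideal.map_mono (F.pow_le r s)
  mul_le r s r' s' := by
    rw [← Ideal.map_mul]
    exact Ideal.map_mono (F.mul_le r s r' s')
  anti r s r' s' hr hs := Ideal.map_mono (F.anti r s r' s' hr hs)

lemma Filtration.IsAdmissible.map {F : Filtration I J} (hF : F.IsAdmissible) {S : Type*}
    [CommRing S] {f : R →+* S} (hf : Function.Surjective f) : (F.map f).IsAdmissible where
  eq_posPart r s := congrArg (Ideal.map f) (hF.eq_posPart r s)
  finite := by
    refine finite_inclusion_of_ringHom (AddMonoidAlgebra.mapRingHom (ℤ × ℤ) f) ?_ ?_ ?_ hF.finite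
    · intro g hg n
      rw [AddMonoidAlgebra.coeff_mapRingHom]
      have := Ideal.mem_map_of_mem f (hg n)
      simpa only [adicFiltration, idealZPow_map, Ideal.map_mul] using this
    · intro g hg n
      rw [AddMonoidAlgebra.coeff_mapRingHom]
      exact Ideal.mem_map_of_mem f (hg n)
    · intro g hg
      have hex : ∀ n, ∃ c ∈ F.ideal n.1 n.2, f c = g.coeff n := fun n =>
        (Ideal.mem_map_iff_of_surjective f hf).mp (hg n)
      choose c hc hcg using hex
      refine ⟨∑ n ∈ g.coeff.support, AddMonoidAlgebra.single n (c n),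
        Subalgebra.sum_mem _ fun n _ => single_mem_extendedReesRing (hc n), ?_⟩
      rw [map_sum]
      conv_rhs => rw [← AddMonoidAlgebra.sum_coeff_single g]
      refine Finset.sum_congr rfl fun n _ => ?_
      rw [AddMonoidAlgebra.mapRingHom_single, hcg]

end Transfer

/-! ### Hilbert functions in dimension one. -/

section DimensionOne

variable {R : Type*} [CommRing R] {I J : Ideal R}

lemma Filtration.mul_span_le (F : Filtration I J) {a : R} (ha : a ∈ I) (r s : ℤ) :
    Ideal.span {a} * F.ideal r s ≤ F.ideal (r + 1) s := by
  have h1 : Ideal.span {a} ≤ F.ideal 1 0 := by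
    refine le_trans ?_ (F.pow_le 1 0)
    simpa [idealZPow, Ideal.span_le] using ha
  refine (Ideal.mul_mono_left h1).trans ((F.mul_le 1 0 r s).trans_eq ?_)
  rw [add_comm, zero_add]

lemma colonElem_span_mul {a : R} (ha : a ∈ nonZeroDivisors R) (K : Ideal R) :
    colonElem (Ideal.span {a} * K) a = K := by
  ext x
  rw [mem_colonElem, Ideal.mem_span_singleton_mul]
  constructor
  · rintro ⟨z, hz, h⟩
    rwa [← (mul_cancel_left_mem_nonZeroDivisors ha).mp h]
  · exact fun hx => ⟨x, hx, rfl⟩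

variable [IsLocalRing R]

lemma Filtration.containsMaxPow (F : Filtration I J) (hI : ContainsMaxPow I)
    (hJ : ContainsMaxPow J) (r s : ℤ) : ContainsMaxPow (F.ideal r s) :=
  ((hI.pow _).mul (hJ.pow _)).mono (F.pow_le r s)

variable [IsNoetherianRing R]

/-- Additivity along a applies with (aK : a) = K and aK + (a) = (a). -/
lemma colength_span_mul {a : R} (ha : a ∈ nonZeroDivisors R) {K : Ideal R}
    (h : ContainsMaxPow (Ideal.span {a})) (hK : ContainsMaxPow K) :
    colength (Ideal.span {a} * K) = colength K + colength (Ideal.span {a}) := by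
  rw [(h.mul hK).colength_eq_add a, colonElem_span_mul ha, sup_eq_right.mpr Ideal.mul_le_left]

lemma colength_span_pow_mul_pow {a b : R} (ha : a ∈ nonZeroDivisors R)
    (hb : b ∈ nonZeroDivisors R) (hca : ContainsMaxPow (Ideal.span {a}))
    (hcb : ContainsMaxPow (Ideal.span {b})) (r s : ℕ) :
    ContainsMaxPow (Ideal.span {a ^ r * b ^ s}) ∧ colength (Ideal.span {a ^ r * b ^ s}) =
      r * colength (Ideal.span {a}) + s * colength (Ideal.span {b}) := by
  induction r with
  | zero =>
    induction s with
    | zero => simpa [colength_top] using ⟨0, le_top⟩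
    | succ s ih =>
      have h : Ideal.span {a ^ 0 * b ^ (s + 1)} =
          Ideal.span {b} * Ideal.span {a ^ 0 * b ^ s} := by
        rw [Ideal.span_singleton_mul_span_singleton]
        congr 2
        ring
      rw [h]
      refine ⟨hcb.mul ih.1, ?_⟩
      rw [colength_span_mul hb hcb ih.1, ih.2]
      push_cast
      ring
  | succ r ih =>
    have h : Ideal.span {a ^ (r + 1) * b ^ s} =
        Ideal.span {a} * Ideal.span {a ^ r * b ^ s} := by
      rw [Ideal.span_singleton_mul_span_singleton]
      congr 2
      ring
    rw [h]
    refine ⟨hca.mul ih.1, ?_⟩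
    rw [colength_span_mul ha hca ih.1, ih.2]
    push_cast
    ring

lemma Filtration.hilbertFunction_succ_le (F : Filtration I J) (hI : ContainsMaxPow I)
    (hJ : ContainsMaxPow J) {a : R} (haI : a ∈ I) (ha : a ∈ nonZeroDivisors R)
    (hca : ContainsMaxPow (Ideal.span {a})) (r s : ℤ) :
    F.hilbertFunction (r + 1) s ≤ F.hilbertFunction r s + colength (Ideal.span {a}) := by
  have hK := F.containsMaxPow hI hJ r s
  exact ((hca.mul hK).colength_le (F.mul_span_le haI r s)).trans (colength_span_mul ha hca hK).le

variable [Infinite (ResidueField R)]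

/-- In dimension one, some regular element of `I` satisfies `F (r + 1, s) = a F (r, s)` for large
`r` and all `s`. -/
lemma Filtration.IsAdmissible.exists_reduction {F : Filtration I J} (hF : F.IsAdmissible)
    (hd : ringKrullDim R ≤ 1) (h0 : DepthPos (⊥ : Ideal R)) (hI : ContainsMaxPow I)
    (hIm : I ≤ maximalIdeal R) :
    ∃ a ∈ I, a ∈ nonZeroDivisors R ∧ ∃ N : ℕ, ∀ r s : ℤ, N ≤ r →
      F.ideal (r + 1) s = Ideal.span {a} * F.ideal r s := by
  obtain ⟨a, haI, ha, hsup⟩ := ((generic_mem_nonZeroDivisors h0 hI).and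
    hF.generic_superficial).exists
  obtain ⟨N, hN⟩ := hsup ha
  obtain ⟨N', hN'⟩ := hF.exists_le_idealZPow
  obtain ⟨k, hk⟩ := containsMaxPow_span_singleton hd ha
  -- N is for superficiality; N' and k place F(r+1,s) inside the k-th power of the maximal ideal,
  -- hence inside (a).
  refine ⟨a, haI, ha, N + N' + k, fun r s hr => le_antisymm (fun x hx => ?_)
    (F.mul_span_le haI r s)⟩
  push_cast at hr
  have hxa : x ∈ Ideal.span {a} := by
    refine hk (Ideal.pow_le_pow_right ?_ (Ideal.pow_right_mono hIm _ (hN' _ _ hx)))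
    omega
  obtain ⟨y, rfl⟩ := Ideal.mem_span_singleton.mp hxa
  exact Ideal.mem_span_singleton_mul.mpr ⟨y, hN r s (by omega) y hx, rfl⟩

/-- The Hilbert function of an admissible filtration in dimension one. -/
theorem Filtration.IsAdmissible.exists_hilbertFunction_eq {F : Filtration I J}
    (hF : F.IsAdmissible) (hd : ringKrullDim R ≤ 1) (h0 : DepthPos (⊥ : Ideal R))
    (hI : ContainsMaxPow I) (hIm : I ≤ maximalIdeal R) (hJ : ContainsMaxPow J)
    (hJm : J ≤ maximalIdeal R) :
    ∃ a ∈ I, ∃ b ∈ J, ∃ c : ℤ, ∃ N : ℕ,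
      (∀ r s : ℤ, N ≤ r → N ≤ s → F.hilbertFunction r s =
        r * colength (Ideal.span {a}) + s * colength (Ideal.span {b}) - c) ∧
      (c = 0 → ∀ r s : ℕ, F.ideal r s = Ideal.span {a ^ r * b ^ s} ∧ F.hilbertFunction r s =
        r * colength (Ideal.span {a}) + s * colength (Ideal.span {b})) := by
  obtain ⟨a, haI, ha, N, hN⟩ := hF.exists_reduction hd h0 hI hIm
  obtain ⟨b, hbJ, hb, N', hN'⟩ := hF.swap.exists_reduction hd h0 hJ hJm
  have hca := containsMaxPow_span_singleton hd ha
  have hcb := containsMaxPow_span_singleton hd hb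
  set α := colength (Ideal.span {a})
  set β := colength (Ideal.span {b})
  -- The gap g increases weakly because aF(r,s) ⊆ F(r+1,s), and is constant once this is an
  -- equality.
  let g : ℤ → ℤ → ℤ := fun r s => r * α + s * β - F.hilbertFunction r s
  have hgr : ∀ s, Monotone fun r => g r s := fun s => monotone_int_of_le_succ fun r => by
    have := F.hilbertFunction_succ_le hI hJ haI ha hca r s
    simp only [g]
    linarith
  have hgs : ∀ r, Monotone fun s => g r s := fun r => monotone_int_of_le_succ fun s => by
    have : F.hilbertFunction r (s + 1) ≤ F.hilbertFunction r s + β :=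
      F.swap.hilbertFunction_succ_le hJ hI hbJ hb hcb s r
    simp only [g]
    linarith
  have hgr' : ∀ r s, (N : ℤ) ≤ r → g r s = g N s := by
    intro r s hr
    induction r, hr using Int.leInduction with
    | base => rfl
    | succ r hr ih =>
      have h1 : F.hilbertFunction (r + 1) s = F.hilbertFunction r s + α := by
        change colength (F.ideal (r + 1) s) = colength (F.ideal r s) + α
        rw [hN r s hr, colength_span_mul ha hca (F.containsMaxPow hI hJ r s)]
      rw [← ih]
      simp only [g, h1]
      ring
  have hgs' : ∀ r s, (N' : ℤ) ≤ s → g r s = g r N' := by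
    intro r s hs
    induction s, hs using Int.leInduction with
    | base => rfl
    | succ s hs ih =>
      have h1 : F.hilbertFunction r (s + 1) = F.hilbertFunction r s + β := by
        change colength (F.swap.ideal (s + 1) r) = colength (F.ideal r s) + β
        rw [hN' s r hs, colength_span_mul hb hcb (F.swap.containsMaxPow hJ hI s r)]
        rfl
      rw [← ih]
      simp only [g, h1]
      ring
  refine ⟨a, haI, b, hbJ, g N N', N + N', fun r s hr hs => ?_, fun hc r s => ?_⟩
  · push_cast at hr hs
    have : g r s = g N N' := by rw [hgr' r s (by omega), hgs' N s (by omega)]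
    simp only [g] at this ⊢
    linarith
  · have h1 : g 0 0 ≤ g r s :=
      (hgr 0 (Int.natCast_nonneg r)).trans (hgs r (Int.natCast_nonneg s))
    have h2 : g r s ≤ g (r + N) (s + N') :=
      (hgr s (by simp : (r : ℤ) ≤ r + N)).trans (hgs (r + N) (by simp : (s : ℤ) ≤ s + N'))
    rw [hgr' (r + N) _ (by omega), hgs' _ (s + N') (by omega), hc] at h2
    have h3 : g 0 0 = 0 := by
      have : F.hilbertFunction 0 0 = 0 := by
        change colength (F.ideal 0 0) = 0
        rw [F.ideal_eq_top le_rfl le_rfl, colength_top]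
      simp [g, this]
    have h4 : F.hilbertFunction r s = r * α + s * β := by
      simp only [g] at h1 h2 h3
      linarith
    obtain ⟨hcm, hcl⟩ := colength_span_pow_mul_pow ha hb hca hcb r s
    refine ⟨(hcm.eq_of_colength_le ?_ ?_).symm, h4⟩
    · refine le_trans ?_ (F.pow_le r s)
      rw [Ideal.span_singleton_le_iff_mem]
      exact Ideal.mul_mem_mul (by simpa [idealZPow] using Ideal.pow_mem_pow haI r)
        (by simpa [idealZPow] using Ideal.pow_mem_pow hbJ s)
    · rw [hcl]
      exact h4.ge

end DimensionOne

/-! ### Testing membership in I^r J^s modulo elements in general position. -/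

section Intersection

variable {R : Type*} [CommRing R]

/-- `a` and `c` generate an ideal containing `I`, and `a` is regular modulo `c`. -/
def RegularPair (I : Ideal R) (a c : R) : Prop :=
  I ≤ Ideal.span {a} ⊔ Ideal.span {c} ∧ ∀ z, a * z ∈ Ideal.span {c} → z ∈ Ideal.span {c}

/-- Modulo c the ideal I is generated by a, so IK becomes aK and the regular element a cancels. -/
lemma RegularPair.mem_of_mul_mem {I K : Ideal R} {a c g : R} (h : RegularPair I a c)
    (hg : a * g ∈ I * K ⊔ Ideal.span {c}) : g ∈ K ⊔ Ideal.span {c} := by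
  have hle : I * K ⊔ Ideal.span {c} ≤ Ideal.span {a} * K ⊔ Ideal.span {c} := by
    refine sup_le ((Ideal.mul_mono_left h.1).trans ?_) le_sup_right
    rw [Ideal.sup_mul]
    exact sup_le_sup_left Ideal.mul_le_left _
  obtain ⟨y, hy, t, ht, hyt⟩ := Submodule.mem_sup.mp (hle hg)
  obtain ⟨k, hk, rfl⟩ := Ideal.mem_span_singleton_mul.mp hy
  have h1 : g - k ∈ Ideal.span {c} := by
    refine h.2 _ ?_
    have : a * (g - k) = t := by linear_combination -hyt
    rwa [this]
  exact Submodule.mem_sup.mpr ⟨k, hk, g - k, h1, by ring⟩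

/-- Membership in `I ^ n K` can be tested modulo sufficiently many elements in general position. -/
lemma mem_pow_mul_of_forall_mem_sup {I K : Ideal R} (C : List R)
    (hK : ∀ g, (∀ c ∈ C, g ∈ K ⊔ Ideal.span {c}) → g ∈ K) (as : List R)
    (hI : ∀ a ∈ as, a ∈ I) (hpair : as.Pairwise (RegularPair I))
    (hC : ∀ a ∈ as, ∀ c ∈ C, RegularPair I a c) {f : R}
    (hfa : ∀ a ∈ as, f ∈ I ^ as.length * K ⊔ Ideal.span {a})
    (hfc : ∀ c ∈ C, f ∈ I ^ as.length * K ⊔ Ideal.span {c}) : f ∈ I ^ as.length * K := by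
  induction as generalizing f with
  | nil =>
    rw [List.length_nil, pow_zero, one_mul] at hfc ⊢
    exact hK f hfc
  | cons a as ih =>
    rw [List.pairwise_cons] at hpair
    simp only [List.mem_cons, forall_eq_or_imp, List.length_cons, pow_succ', mul_assoc]
      at hI hC hfa hfc ⊢
    -- Write f = h + ag with h in the target ideal. Against every other test element a cancels,
    -- leaving the same problem for g with one power of I and one test element fewer.
    obtain ⟨h, hh, t, ht, rfl⟩ := Submodule.mem_sup.mp hfa.1
    obtain ⟨g, rfl⟩ := Ideal.mem_span_singleton.mp ht
    have hstep : ∀ c, RegularPair I a c → h + a * g ∈ I * (I ^ as.length * K) ⊔ Ideal.span {c} →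
        g ∈ I ^ as.length * K ⊔ Ideal.span {c} := by
      intro c hac hc
      refine hac.mem_of_mul_mem ?_
      have := Ideal.sub_mem _ hc (Ideal.mem_sup_left hh)
      rwa [add_sub_cancel_left] at this
    have hg : g ∈ I ^ as.length * K :=
      ih hI.2 hpair.2 hC.2 (fun c hc => hstep c (hpair.1 c hc) (hfa.2 c hc))
        fun c hc => hstep c (hC.1 c hc) (hfc c hc)
    exact Ideal.add_mem _ hh (Ideal.mul_mem_mul hI.1 hg)

/-- The colon ideal `(I ^ (n + 1) K : a)` is `I ^ n K` for elements in general position. -/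
lemma colonElem_pow_mul {I K : Ideal R} (C : List R)
    (hK : ∀ g, (∀ c ∈ C, g ∈ K ⊔ Ideal.span {c}) → g ∈ K) (a : R) (as : List R)
    (hI : ∀ a' ∈ a :: as, a' ∈ I) (hpair : (a :: as).Pairwise (RegularPair I))
    (hC : ∀ a' ∈ a :: as, ∀ c ∈ C, RegularPair I a' c) :
    colonElem (I ^ (as.length + 1) * K) a = I ^ as.length * K := by
  rw [List.pairwise_cons] at hpair
  simp only [List.mem_cons, forall_eq_or_imp] at hI hC
  rw [pow_succ', mul_assoc]
  refine le_antisymm (fun x hx => ?_) fun x hx => Ideal.mul_mem_mul hI.1 hx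
  rw [mem_colonElem] at hx
  exact mem_pow_mul_of_forall_mem_sup C hK as hI.2 hpair.2 hC.2
    (fun c hc => (hpair.1 c hc).mem_of_mul_mem (Ideal.mem_sup_left hx))
    fun c hc => (hC.1 c hc).mem_of_mul_mem (Ideal.mem_sup_left hx)

/-- The pure-power case; it supplies the hypothesis on K when K = J^s in the mixed case. -/
lemma mem_pow_of_forall_mem_sup {J : Ideal R} (bs : List R) (hJ : ∀ b ∈ bs, b ∈ J)
    (hpair : bs.Pairwise (RegularPair J)) {g : R}
    (hg : ∀ b ∈ bs, g ∈ J ^ bs.length ⊔ Ideal.span {b}) : g ∈ J ^ bs.length := by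
  have := mem_pow_mul_of_forall_mem_sup (I := J) (K := ⊤) [] (by simp) bs hJ hpair (by simp)
    (f := g) (by simpa using hg) (by simp)
  simpa using this

variable [IsLocalRing R]

/-- It suffices that a avoid (c) + 𝔪I: modulo c, a is then a unit multiple of the generator x, and
positive depth makes it regular. By Nakayama I is not contained in (c) + 𝔪I, since (c) contains no
power of 𝔪. -/
lemma generic_regularPair [IsNoetherianRing R] {I : Ideal R} {c : R} (hI : ContainsMaxPow I)
    (hcm : c ∈ maximalIdeal R) (hc : DepthPos (Ideal.span {c}))
    (hx : ∃ x ∈ I, I ≤ Ideal.span {x} ⊔ Ideal.span {c}) :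
    Generic I (fun a => RegularPair I a c) := by
  obtain ⟨x, hxI, hx⟩ := hx
  have hctop : Ideal.span {c} ≠ ⊤ := fun h => by
    rw [Ideal.span_singleton_eq_top] at h
    exact (mem_maximalIdeal c).mp hcm h
  have hnot : ¬ I ≤ Ideal.span {c} ⊔ maximalIdeal R * I := by
    intro hle
    refine hc.not_containsMaxPow hctop (hI.mono ?_)
    exact Submodule.le_of_le_smul_of_le_jacobson_bot (IsNoetherian.noetherian I)
      (IsLocalRing.maximalIdeal_le_jacobson _) hle
  refine (generic_notMem hnot).mono fun a haI ha => ?_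
  have hIac : I ≤ Ideal.span {a} ⊔ Ideal.span {c} := by
    obtain ⟨y, hy, z, hz, hyz⟩ := Submodule.mem_sup.mp (hx haI)
    obtain ⟨p, rfl⟩ := Ideal.mem_span_singleton'.mp hy
    have hp : IsUnit p := by
      by_contra hp
      refine ha (Submodule.mem_sup.mpr ⟨z, hz, p * x, ?_, by rw [← hyz]; ring⟩)
      exact Ideal.mul_mem_mul ((mem_maximalIdeal p).mpr hp) hxI
    refine hx.trans (sup_le ?_ le_sup_right)
    rw [Ideal.span_singleton_le_iff_mem, ← Ideal.unit_mul_mem_iff_mem _ hp]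
    refine Submodule.mem_sup.mpr ⟨a, Ideal.mem_span_singleton_self a, -z,
      Submodule.neg_mem _ hz, by rw [← hyz]; ring⟩
  exact ⟨hIac, fun z hz => hc.mem_of_mul_mem (hI.mono hIac) hz⟩

/-- Elements are added one at a time, each generic relative to C and to those already chosen. -/
lemma exists_list_pairwise_regularPair [Infinite (ResidueField R)] {I : Ideal R} {p : R → Prop}
    (hp : Generic I p) (h : ∀ c ∈ I, p c → Generic I (fun a => RegularPair I a c)) (C : List R)
    (hC : ∀ c ∈ C, Generic I (fun a => RegularPair I a c)) (n : ℕ) :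
    ∃ as : List R, as.length = n ∧ (∀ a ∈ as, a ∈ I ∧ p a) ∧ as.Pairwise (RegularPair I) ∧
      ∀ a ∈ as, ∀ c ∈ C, RegularPair I a c := by
  induction n with
  | zero => exact ⟨[], by simp⟩
  | succ n ih =>
    obtain ⟨as, hlen, hIp, hpair, hasC⟩ := ih
    obtain ⟨a, haI, ⟨hpa, haas⟩, haC⟩ := ((hp.and (generic_forall_list as
      fun c hc => h c (hIp c hc).1 (hIp c hc).2)).and (generic_forall_list C hC)).exists
    refine ⟨a :: as, by simp [hlen], ?_, List.pairwise_cons.mpr ⟨haas, hpair⟩, ?_⟩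
    · simpa using ⟨⟨haI, hpa⟩, hIp⟩
    · simpa using ⟨haC, hasC⟩

end Intersection

/-! ### Hilbert coefficients read off from first differences. -/

section Polynomial

variable {R : Type*} [CommRing R] {I J : Ideal R}

lemma binomialPolynomial_one (e : ℕ × ℕ → ℤ) (r s : ℤ) :
    binomialPolynomial 1 e r s = e (1, 0) * r + e (0, 1) * s - e (0, 0) := by
  simp [binomialPolynomial, Finset.sum_range_succ, Finset.Nat.antidiagonal_succ]
  ring

lemma binomialPolynomial_two (e : ℕ × ℕ → ℤ) (r s : ℤ) :
    binomialPolynomial 2 e r s = e (2, 0) * Ring.choose (r + 1) 2 + e (1, 1) * r * s +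
      e (0, 2) * Ring.choose (s + 1) 2 - e (1, 0) * r - e (0, 1) * s + e (0, 0) := by
  have h : ∀ x : ℤ, x + 2 - 1 = x + 1 := fun x => by ring
  simp [binomialPolynomial, Finset.sum_range_succ, Finset.Nat.antidiagonal_succ, h]
  ring

lemma choose_add_two_two (r : ℤ) :
    Ring.choose (r + 1 + 1) 2 = Ring.choose (r + 1) 2 + (r + 1) := by
  rw [Ring.choose_succ_succ, Ring.choose_one_right, add_comm]

lemma Filtration.IsHilbertCoeff.swap {F : Filtration I J} {e : ℕ × ℕ → ℤ}
    (he : F.IsHilbertCoeff 2 e) : F.swap.IsHilbertCoeff 2 (e ∘ Prod.swap) := by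
  obtain ⟨h0, N, hN⟩ := he
  refine ⟨fun α hα => h0 _ (by simpa [add_comm] using hα), N, fun r s hr hs => ?_⟩
  change F.hilbertFunction s r = _
  rw [hN s r hs hr, binomialPolynomial_two, binomialPolynomial_two]
  simp only [Function.comp_apply, Prod.swap_prod_mk]
  ring

lemma Filtration.isHilbertCoeff_hilbertCoeff {F : Filtration I J} {d : ℕ}
    (h : ∃ e, F.IsHilbertCoeff d e) : F.IsHilbertCoeff d (F.hilbertCoeff d) := by
  rw [Filtration.hilbertCoeff, dif_pos h]
  exact h.choose_spec

lemma Filtration.exists_isHilbertCoeff_one {F : Filtration I J} {α β c : ℤ} {N : ℕ}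
    (h : ∀ r s : ℤ, N ≤ r → N ≤ s → F.hilbertFunction r s = r * α + s * β - c) :
    ∃ e, F.IsHilbertCoeff 1 e := by
  refine ⟨fun p => if p = (1, 0) then α else if p = (0, 1) then β else
    if p = (0, 0) then c else 0, fun p hp => ?_, N, fun r s hr hs => ?_⟩
  · obtain ⟨i, j⟩ := p
    dsimp only at hp
    simp only [Prod.mk.injEq]
    split_ifs <;> first | rfl | omega
  · rw [h r s hr hs, binomialPolynomial_one]
    simp
    ring

lemma Filtration.IsHilbertCoeff.eq_of_one {F : Filtration I J} {e : ℕ × ℕ → ℤ}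
    (he : F.IsHilbertCoeff 1 e) {α β c : ℤ} {N : ℕ}
    (h : ∀ r s : ℤ, N ≤ r → N ≤ s → F.hilbertFunction r s = r * α + s * β - c) :
    e (1, 0) = α ∧ e (0, 1) = β ∧ e (0, 0) = c := by
  obtain ⟨-, N', hN'⟩ := he
  let M := max (N : ℤ) N'
  have hM : (N : ℤ) ≤ M ∧ N' ≤ M := ⟨le_max_left _ _, le_max_right _ _⟩
  generalize M = m at hM
  have h1 : ∀ r s : ℤ, m ≤ r → m ≤ s →
      e (1, 0) * r + e (0, 1) * s - e (0, 0) = r * α + s * β - c := fun r s hr hs => by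
    rw [← binomialPolynomial_one, ← hN' r s (by omega) (by omega), h r s (by omega) (by omega)]
  have h2 := h1 m m le_rfl le_rfl
  have h3 := h1 (m + 1) m (by omega) le_rfl
  have h4 := h1 m (m + 1) le_rfl (by omega)
  have h5 : e (1, 0) = α := by linarith
  have h6 : e (0, 1) = β := by linarith
  subst h5 h6
  exact ⟨rfl, rfl, by linarith⟩

lemma Filtration.exists_isHilbertCoeff_two {F : Filtration I J} {α β c α' β' c' : ℤ} {N : ℕ}
    (h : ∀ r s : ℤ, N ≤ r → N ≤ s →
      F.hilbertFunction (r + 1) s = F.hilbertFunction r s + ((r + 1) * α + s * β - c))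
    (h' : ∀ r s : ℤ, N ≤ r → N ≤ s →
      F.hilbertFunction r (s + 1) = F.hilbertFunction r s + ((s + 1) * α' + r * β' - c')) :
    ∃ e, F.IsHilbertCoeff 2 e := by
  -- Both are the mixed second difference of H, computed in the two orders.
  have hβ : β = β' := by
    have h1 := h N (N + 1) le_rfl (by omega)
    have h2 := h N N le_rfl le_rfl
    have h3 := h' (N + 1) N (by omega) le_rfl
    have h4 := h' N N le_rfl le_rfl
    linarith
  subst hβ
  let Q : ℤ → ℤ → ℤ := fun r s => α * Ring.choose (r + 1) 2 + β * r * s +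
      α' * Ring.choose (s + 1) 2 - c * r - c' * s
  have key : ∀ r s : ℤ, N ≤ r → N ≤ s →
      F.hilbertFunction r s = Q r s + (F.hilbertFunction N N - Q N N) := by
    intro r s hr hs
    induction r, hr using Int.leInduction with
    | base =>
      induction s, hs using Int.leInduction with
      | base => ring
      | succ s hs ih =>
        rw [h' N s le_rfl hs, ih]
        simp only [Q, choose_add_two_two]
        ring
    | succ r hr ih =>
      rw [h r s hr hs, ih]
      simp only [Q, choose_add_two_two]
      ring
  refine ⟨fun p => if p = (2, 0) then α else if p = (1, 1) then β else if p = (0, 2) then α' else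
    if p = (1, 0) then c else if p = (0, 1) then c' else
    if p = (0, 0) then F.hilbertFunction N N - Q N N else 0, fun p hp => ?_, N,
    fun r s hr hs => ?_⟩
  · obtain ⟨i, j⟩ := p
    dsimp only at hp
    simp only [Prod.mk.injEq]
    split_ifs <;> first | rfl | omega
  · rw [key r s hr hs, binomialPolynomial_two]
    simp [Q]

/-- The first difference of P in r is (r+1)e_(2,0) + s e_(1,1) - e_(1,0), a linear form determined
by three values. -/
lemma Filtration.IsHilbertCoeff.eq_of_two {F : Filtration I J} {e : ℕ × ℕ → ℤ}
    (he : F.IsHilbertCoeff 2 e) {α β c : ℤ} {N : ℕ}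
    (h : ∀ r s : ℤ, N ≤ r → N ≤ s →
      F.hilbertFunction (r + 1) s = F.hilbertFunction r s + ((r + 1) * α + s * β - c)) :
    e (2, 0) = α ∧ e (1, 1) = β ∧ e (1, 0) = c := by
  obtain ⟨-, N', hN'⟩ := he
  let M := max (N : ℤ) N'
  have hM : (N : ℤ) ≤ M ∧ N' ≤ M := ⟨le_max_left _ _, le_max_right _ _⟩
  generalize M = m at hM
  have h1 : ∀ r s : ℤ, m ≤ r → m ≤ s →
      (r + 1) * e (2, 0) + s * e (1, 1) - e (1, 0) = (r + 1) * α + s * β - c := by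
    intro r s hr hs
    have := h r s (by omega) (by omega)
    rw [hN' r s (by omega) (by omega), hN' (r + 1) s (by omega) (by omega),
      binomialPolynomial_two, binomialPolynomial_two, choose_add_two_two] at this
    linarith
  have h2 := h1 m m le_rfl le_rfl
  have h3 := h1 (m + 1) m (by omega) le_rfl
  have h4 := h1 m (m + 1) le_rfl (by omega)
  have h5 : e (2, 0) = α := by linarith
  have h6 : e (1, 1) = β := by linarith
  subst h5 h6
  exact ⟨rfl, rfl, by linarith⟩

end Polynomial

/-! ### Filtrations that become principal modulo an element. -/

section PrincipalModulo

variable {R : Type*} [CommRing R] {I J : Ideal R}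

/-- Modulo `a` the filtration is `{x ^ r y ^ s}`, with Hilbert function `r α + s β`. -/
def Filtration.IsPrincipalModulo (F : Filtration I J) (α β : ℤ) (a : R) : Prop :=
  ∃ x ∈ I, ∃ y ∈ J, ∀ r s : ℕ,
    F.ideal r s ⊔ Ideal.span {a} = Ideal.span {x ^ r * y ^ s} ⊔ Ideal.span {a} ∧
    colength (F.ideal r s ⊔ Ideal.span {a}) = r * α + s * β

/-- Modulo a, I^r J^s is squeezed between (x^r y^s) and F(r,s). -/
lemma Filtration.IsPrincipalModulo.sup_eq {F : Filtration I J} {α β : ℤ} {a : R}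
    (h : F.IsPrincipalModulo α β a) (r s : ℕ) :
    F.ideal r s ⊔ Ideal.span {a} = I ^ r * J ^ s ⊔ Ideal.span {a} := by
  obtain ⟨x, hx, y, hy, h⟩ := h
  refine le_antisymm ?_ (sup_le_sup_right ?_ _)
  · rw [(h r s).1]
    refine sup_le_sup_right ?_ _
    rw [Ideal.span_singleton_le_iff_mem]
    exact Ideal.mul_mem_mul (Ideal.pow_mem_pow hx r) (Ideal.pow_mem_pow hy s)
  · simpa [idealZPow] using F.pow_le r s

end PrincipalModulo

/-! ### Reduction of dimension two to dimension one. -/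

section DimensionTwo

variable {R : Type*} [CommRing R] [IsLocalRing R] {I J : Ideal R}

/-- Conditions on a two-dimensional Cohen-Macaulay local ring: the dimension is at most two and the
depth is at least two. -/
structure IsDepthTwo (R : Type*) [CommRing R] [IsLocalRing R] : Prop where
  dim_le : ringKrullDim R ≤ 2
  depthPos_bot : DepthPos (⊥ : Ideal R)
  depthPos_span : ∀ a ∈ maximalIdeal R, a ∈ nonZeroDivisors R → DepthPos (Ideal.span {a})

variable [IsNoetherianRing R]

lemma Filtration.hilbertFunction_succ_eq (F : Filtration I J) (hI : ContainsMaxPow I)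
    (hJ : ContainsMaxPow J) {a : R} (haI : a ∈ I) {r s : ℤ}
    (h : ∀ x, a * x ∈ F.ideal (r + 1) s → x ∈ F.ideal r s) :
    F.hilbertFunction (r + 1) s =
      F.hilbertFunction r s + colength (F.ideal (r + 1) s ⊔ Ideal.span {a}) := by
  have h1 : colonElem (F.ideal (r + 1) s) a = F.ideal r s :=
    le_antisymm h fun x hx => F.mul_span_le haI r s (Ideal.mem_span_singleton_mul.mpr ⟨x, hx, rfl⟩)
  have h2 := (F.containsMaxPow hI hJ (r + 1) s).colength_eq_add a
  rw [h1] at h2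
  exact h2

/-- `a` computes the differences `H (r + 1, s) - H (r, s)` for `r ≥ N`. -/
def Filtration.IsSuperficial (F : Filtration I J) (a : R) : Prop :=
  ∃ N : ℕ, ∀ r s : ℤ, N ≤ r → F.hilbertFunction (r + 1) s =
    F.hilbertFunction r s + colength (F.ideal (r + 1) s ⊔ Ideal.span {a})

variable [Infinite (ResidueField R)]

/-- The first difference of H is the Hilbert function of the image of F in R/a, a ring of dimension
at most one and positive depth, so the dimension-one theorem applies there. The constant c of that
theorem will turn out to be e_(1,0). -/
lemma Filtration.IsAdmissible.generic_difference {F : Filtration I J} (hF : F.IsAdmissible)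
    (hR : IsDepthTwo R) (hI : ContainsMaxPow I) (hIm : I ≤ maximalIdeal R)
    (hJ : ContainsMaxPow J) (hJm : J ≤ maximalIdeal R) :
    Generic I fun a => a ∈ nonZeroDivisors R ∧ F.IsSuperficial a ∧ ∃ (α β c : ℤ) (N : ℕ),
      (∀ r s : ℤ, N ≤ r → N ≤ s →
        F.hilbertFunction (r + 1) s = F.hilbertFunction r s + ((r + 1) * α + s * β - c)) ∧
      (c = 0 → F.IsPrincipalModulo α β a) := by
  refine ((generic_mem_nonZeroDivisors hR.depthPos_bot hI).and hF.generic_superficial).mono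
    fun a haI ⟨ha, hsup⟩ => ?_
  obtain ⟨N, hN⟩ := hsup ha
  have hsuc : ∀ r s : ℤ, N ≤ r → F.hilbertFunction (r + 1) s =
      F.hilbertFunction r s + colength (F.ideal (r + 1) s ⊔ Ideal.span {a}) := fun r s hr =>
    F.hilbertFunction_succ_eq hI hJ haI (hN r s hr)
  refine ⟨ha, ⟨N, hsuc⟩, ?_⟩
  set π := Ideal.Quotient.mk (Ideal.span {a}) with hπ
  have hπs : Function.Surjective π := Ideal.Quotient.mk_surjective
  have hne : Ideal.span {a} ≠ ⊤ := fun h => by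
    rw [Ideal.span_singleton_eq_top] at h
    exact (mem_maximalIdeal a).mp (hIm haI) h
  have : Nontrivial (R ⧸ Ideal.span {a}) := Ideal.Quotient.nontrivial_iff.mpr hne
  have : IsLocalRing (R ⧸ Ideal.span {a}) := IsLocalRing.of_surjective' π hπs
  have : Infinite (ResidueField (R ⧸ Ideal.span {a})) := infinite_residueField_quotient _
  have hd : ringKrullDim (R ⧸ Ideal.span {a}) ≤ 1 := by
    have h1 := (ringKrullDim_quotient_succ_le_of_nonZeroDivisor ha).trans hR.dim_le
    generalize ringKrullDim (R ⧸ Ideal.span {a}) = x at h1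
    induction x with
    | bot => exact bot_le
    | coe x =>
      induction x with
      | top => exact absurd h1 (by decide)
      | coe n =>
        have h2 : (((n + 1 : ℕ) : ℕ∞) : WithBot ℕ∞) ≤ (((2 : ℕ) : ℕ∞) : WithBot ℕ∞) := h1
        norm_cast at h2 ⊢
        omega
  have hmap : (maximalIdeal R).map π = maximalIdeal (R ⧸ Ideal.span {a}) :=
    IsLocalRing.map_maximalIdeal_of_surjective π hπs
  obtain ⟨x', hx', y', hy', c, N', hpoly, hc⟩ := (hF.map hπs).exists_hilbertFunction_eq hd
    (hR.depthPos_span a (hIm haI) ha).quotient (hI.map π hπs) (hmap ▸ Ideal.map_mono hIm)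
    (hJ.map π hπs) (hmap ▸ Ideal.map_mono hJm)
  have hH : ∀ r s, (F.map π).hilbertFunction r s = colength (F.ideal r s ⊔ Ideal.span {a}) :=
    fun r s => colength_map_quotient _ _
  refine ⟨colength (Ideal.span {x'}), colength (Ideal.span {y'}), c, N + N',
    fun r s hr hs => ?_, fun hc0 => ?_⟩
  · push_cast at hr hs
    rw [hsuc r s (by omega), ← hH, hpoly (r + 1) s (by omega) (by omega)]
  · obtain ⟨x, hx, rfl⟩ := (Ideal.mem_map_iff_of_surjective π hπs).mp hx'
    obtain ⟨y, hy, rfl⟩ := (Ideal.mem_map_iff_of_surjective π hπs).mp hy'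
    refine ⟨x, hx, y, hy, fun r s => ⟨?_, ?_⟩⟩
    · have h1 := (hc hc0 r s).1
      change (F.ideal r s).map π = _ at h1
      rw [← map_pow, ← map_pow, ← map_mul, ← Set.image_singleton, ← Ideal.map_span] at h1
      -- Pulling back along the quotient map turns equality in R/a into equality after adding (a).
      have h2 := congrArg (Ideal.comap π) h1
      rwa [Ideal.comap_map_of_surjective π hπs, Ideal.comap_map_of_surjective π hπs,
        ← RingHom.ker_eq_comap_bot, Ideal.mk_ker] at h2
    · rw [← hH, (hc hc0 r s).2]

lemma Filtration.IsAdmissible.exists_isHilbertCoeff_two {F : Filtration I J} (hF : F.IsAdmissible)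
    (hR : IsDepthTwo R) (hI : ContainsMaxPow I) (hIm : I ≤ maximalIdeal R)
    (hJ : ContainsMaxPow J) (hJm : J ≤ maximalIdeal R) : ∃ e, F.IsHilbertCoeff 2 e := by
  obtain ⟨a, -, -, -, α, β, c, N, h, -⟩ := (hF.generic_difference hR hI hIm hJ hJm).exists
  obtain ⟨b, -, -, -, α', β', c', N', h', -⟩ := (hF.swap.generic_difference hR hJ hJm hI hIm).exists
  refine F.exists_isHilbertCoeff_two (α := α) (β := β) (c := c) (α' := α') (β' := β') (c' := c')
    (N := N + N') (fun r s hr hs => ?_) fun r s hr hs => ?_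
  · push_cast at hr hs
    exact h r s (by omega) (by omega)
  · push_cast at hr hs
    exact h' s r (by omega) (by omega)

lemma Filtration.IsAdmissible.generic_isPrincipalModulo {F : Filtration I J} (hF : F.IsAdmissible)
    (hR : IsDepthTwo R) (hI : ContainsMaxPow I) (hIm : I ≤ maximalIdeal R)
    (hJ : ContainsMaxPow J) (hJm : J ≤ maximalIdeal R) {e : ℕ × ℕ → ℤ}
    (he : F.IsHilbertCoeff 2 e) (he0 : e (1, 0) = 0) :
    Generic I fun a => a ∈ nonZeroDivisors R ∧ F.IsPrincipalModulo (e (2, 0)) (e (1, 1)) a := by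
  refine (hF.generic_difference hR hI hIm hJ hJm).mono fun a _ ⟨ha, _, α, β, c, N, h, hc⟩ => ?_
  obtain ⟨rfl, rfl, rfl⟩ := he.eq_of_two h
  exact ⟨ha, hc he0⟩

end DimensionTwo

/-! ### Consequences of being principal modulo an element. -/

section PrincipalModulo

variable {R : Type*} [CommRing R] {I J : Ideal R}

lemma Filtration.IsPrincipalModulo.exists_left {F : Filtration I J} {α β : ℤ} {a : R}
    (h : F.IsPrincipalModulo α β a) : ∃ x ∈ I, I ≤ Ideal.span {x} ⊔ Ideal.span {a} := by
  have h1 := h.sup_eq 1 0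
  obtain ⟨x, hx, y, hy, h⟩ := h
  refine ⟨x, hx, ?_⟩
  rw [(h 1 0).1, pow_one, pow_zero, mul_one, pow_one, pow_zero, Ideal.one_eq_top,
    Ideal.mul_top] at h1
  exact le_sup_left.trans h1.ge

lemma Filtration.IsPrincipalModulo.exists_right {F : Filtration I J} {α β : ℤ} {a : R}
    (h : F.IsPrincipalModulo α β a) : ∃ y ∈ J, J ≤ Ideal.span {y} ⊔ Ideal.span {a} := by
  have h1 := h.sup_eq 0 1
  obtain ⟨x, hx, y, hy, h⟩ := h
  refine ⟨y, hy, ?_⟩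
  rw [(h 0 1).1, pow_one, pow_zero, one_mul, pow_one, pow_zero, one_mul] at h1
  exact le_sup_left.trans h1.ge

lemma Filtration.IsPrincipalModulo.colength_eq {F : Filtration I J} {α β : ℤ} {a : R}
    (h : F.IsPrincipalModulo α β a) (r s : ℕ) :
    colength (I ^ r * J ^ s ⊔ Ideal.span {a}) = r * α + s * β := by
  rw [← h.sup_eq]
  obtain ⟨x, hx, y, hy, h⟩ := h
  exact (h r s).2

lemma Filtration.IsPrincipalModulo.le_sup {F : Filtration I J} {α β : ℤ} {a : R}
    (h : F.IsPrincipalModulo α β a) (r s : ℕ) :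
    F.ideal r s ≤ I ^ r * J ^ s ⊔ Ideal.span {a} :=
  le_sup_left.trans (h.sup_eq r s).le

end PrincipalModulo

/-! ### Two-generated parameter ideals. -/

section ParameterIdeal

variable {R : Type*} [CommRing R] [IsLocalRing R] {I : Ideal R}

lemma isParameterIdeal_of_le_sup (hd : ringKrullDim R = ((2 : ℕ∞) : WithBot ℕ∞))
    (hI : IsMaximalPrimary I) {a x : R} (ha : a ∈ I) (hx : x ∈ I)
    (h : I ≤ Ideal.span {x} ⊔ Ideal.span {a}) : IsParameterIdeal I := by
  have hspan : I = Ideal.span (Set.range ![x, a]) := by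
    rw [Matrix.range_cons, Matrix.range_cons, Matrix.range_empty, Set.union_empty,
      Ideal.span_union]
    exact le_antisymm h (sup_le ((Ideal.span_singleton_le_iff_mem I).mpr hx)
      ((Ideal.span_singleton_le_iff_mem I).mpr ha))
  exact ⟨2, ![x, a], ⟨hd, hspan ▸ hI⟩, hspan⟩

/-- For a parameter ideal, `λ(R / (I ^ n + a)) = n λ(R / I)` if `I = (x, a)`. -/
lemma RegularPair.colength_pow_sup [IsNoetherianRing R] {a x : R} (hI : ContainsMaxPow I) (hx : x ∈ I)
    (ha : a ∈ I)
    (h : RegularPair I x a) (n : ℕ) :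
    colength (I ^ n ⊔ Ideal.span {a}) = n * colength I := by
  induction n with
  | zero => simp [colength_top]
  | succ n ih =>
    -- Regularity of x modulo a removes one power of I, and adding x gives I; each step therefore
    -- contributes λ(R/I).
    have hcolon : colonElem (I ^ (n + 1) ⊔ Ideal.span {a}) x = I ^ n ⊔ Ideal.span {a} := by
      rw [pow_succ']
      refine le_antisymm (fun z hz => h.mem_of_mul_mem hz) fun z hz => ?_
      obtain ⟨y, hy, w, hw, rfl⟩ := Submodule.mem_sup.mp hz
      rw [mem_colonElem, mul_add]
      exact Ideal.add_mem _ (Ideal.mem_sup_left (Ideal.mul_mem_mul hx hy))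
        (Ideal.mem_sup_right (Ideal.mul_mem_left _ _ hw))
    have hsup : I ^ (n + 1) ⊔ Ideal.span {a} ⊔ Ideal.span {x} = I := by
      refine le_antisymm (sup_le (sup_le (Ideal.pow_le_self n.succ_ne_zero) ?_) ?_)
        (h.1.trans (sup_le le_sup_right (le_sup_right.trans le_sup_left)))
      · rwa [Ideal.span_singleton_le_iff_mem]
      · rwa [Ideal.span_singleton_le_iff_mem]
    rw [((hI.pow (n + 1)).mono le_sup_left).colength_eq_add x, hcolon, hsup, ih]
    push_cast
    ring

end ParameterIdeal

/-! ### The equivalence in dimension two. -/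

section DimensionTwo

variable {R : Type*} [CommRing R] [IsLocalRing R] [IsNoetherianRing R] {I J : Ideal R}

variable [Infinite (ResidueField R)]

/-- Elements of `I` and of `J` in general position. -/
lemma Filtration.IsAdmissible.exists_lists {F : Filtration I J} (hF : F.IsAdmissible)
    (hR : IsDepthTwo R) (hI : ContainsMaxPow I) (hIm : I ≤ maximalIdeal R)
    (hJ : ContainsMaxPow J) (hJm : J ≤ maximalIdeal R) {e : ℕ × ℕ → ℤ}
    (he : F.IsHilbertCoeff 2 e) (h10 : e (1, 0) = 0) (h01 : e (0, 1) = 0) (r s : ℕ) :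
    ∃ as bs : List R, as.length = r ∧ bs.length = s ∧
      (∀ a ∈ as, a ∈ I ∧ F.IsPrincipalModulo (e (2, 0)) (e (1, 1)) a) ∧
      (∀ b ∈ bs, b ∈ J ∧ F.swap.IsPrincipalModulo (e (0, 2)) (e (1, 1)) b) ∧
      as.Pairwise (RegularPair I) ∧ bs.Pairwise (RegularPair J) ∧
      ∀ a ∈ as, ∀ b ∈ bs, RegularPair I a b := by
  have hGI := hF.generic_isPrincipalModulo hR hI hIm hJ hJm he h10
  have hGJ := hF.swap.generic_isPrincipalModulo hR hJ hJm hI hIm he.swap h01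
  -- The b's come first, so that the a's can be chosen regular modulo each of them; I is principal
  -- modulo b because the exchanged filtration is.
  obtain ⟨bs, hbs, hbJ, hbp, -⟩ := exists_list_pairwise_regularPair hGJ
    (fun c hc hp => generic_regularPair hJ (hJm hc) (hR.depthPos_span c (hJm hc) hp.1)
      hp.2.exists_left) [] (by simp) s
  obtain ⟨as, has, haI, hap, hab⟩ := exists_list_pairwise_regularPair hGI
    (fun c hc hp => generic_regularPair hI (hIm hc) (hR.depthPos_span c (hIm hc) hp.1)
      hp.2.exists_left) bs (fun b hb => by
        obtain ⟨hbJ', hb0, hbm⟩ := hbJ b hb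
        exact generic_regularPair hI (hJm hbJ') (hR.depthPos_span b (hJm hbJ') hb0)
          hbm.exists_right) r
  exact ⟨as, bs, has, hbs, fun a ha => ⟨(haI a ha).1, (haI a ha).2.2⟩,
    fun b hb => ⟨(hbJ b hb).1, (hbJ b hb).2.2⟩, hap, hbp, hab⟩

/-- If `e_{(1, 0)} = e_{(0, 1)} = 0` then `F (r, s) = I ^ r J ^ s`. -/
theorem Filtration.IsAdmissible.ideal_eq_pow_mul_pow {F : Filtration I J} (hF : F.IsAdmissible)
    (hR : IsDepthTwo R) (hI : ContainsMaxPow I) (hIm : I ≤ maximalIdeal R)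
    (hJ : ContainsMaxPow J) (hJm : J ≤ maximalIdeal R) {e : ℕ × ℕ → ℤ}
    (he : F.IsHilbertCoeff 2 e) (h10 : e (1, 0) = 0) (h01 : e (0, 1) = 0) (r s : ℕ) :
    F.ideal r s = I ^ r * J ^ s := by
  obtain ⟨as, bs, rfl, rfl, haI, hbJ, hap, hbp, hab⟩ :=
    hF.exists_lists hR hI hIm hJ hJm he h10 h01 r s
  refine le_antisymm (fun f hf => ?_) (by simpa [idealZPow] using F.pow_le as.length bs.length)
  -- There are exactly r elements a and s elements b, the numbers the membership test needs for I^r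
  -- J^s.
  refine mem_pow_mul_of_forall_mem_sup bs
    (fun g hg => mem_pow_of_forall_mem_sup bs (fun b hb => (hbJ b hb).1) hbp hg) as
    (fun a ha => (haI a ha).1) hap hab (fun a ha => (haI a ha).2.le_sup _ _ hf) fun b hb => ?_
  have := (hbJ b hb).2.le_sup bs.length as.length hf
  rwa [mul_comm] at this

/-- If `e_{(1, 0)} = e_{(0, 1)} = 0` then the differences of the Hilbert function in the first
variable are those of its Hilbert polynomial. -/
lemma Filtration.IsAdmissible.hilbertFunction_succ {F : Filtration I J} (hF : F.IsAdmissible)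
    (hR : IsDepthTwo R) (hI : ContainsMaxPow I) (hIm : I ≤ maximalIdeal R)
    (hJ : ContainsMaxPow J) (hJm : J ≤ maximalIdeal R) {e : ℕ × ℕ → ℤ}
    (he : F.IsHilbertCoeff 2 e) (h10 : e (1, 0) = 0) (h01 : e (0, 1) = 0) (r s : ℕ) :
    F.hilbertFunction (r + 1) s =
      F.hilbertFunction r s + ((r + 1) * e (2, 0) + s * e (1, 1)) := by
  obtain ⟨as, bs, har, rfl, haI, hbJ, hap, hbp, hab⟩ :=
    hF.exists_lists hR hI hIm hJ hJm he h10 h01 (r + 1) s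
  obtain _ | ⟨a, as⟩ := as
  · simp at har
  obtain rfl : as.length = r := by simpa using har
  -- One extra a plays the role of the superficial element, now with the colon formula valid for
  -- every r ≥ 0.
  have hcolon := colonElem_pow_mul (K := J ^ bs.length) bs
    (fun g hg => mem_pow_of_forall_mem_sup bs (fun b hb => (hbJ b hb).1) hbp hg) a as
    (fun a ha => (haI a ha).1) hap hab
  have heq := hF.ideal_eq_pow_mul_pow hR hI hIm hJ hJm he h10 h01
  have h1 := heq (as.length + 1) bs.length
  push_cast at h1
  change colength (F.ideal (as.length + 1) bs.length) = colength (F.ideal as.length bs.length) + _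
  rw [h1, heq, ((hI.pow _).mul (hJ.pow _)).colength_eq_add a, hcolon,
    (haI a (by simp)).2.colength_eq]
  push_cast
  rfl

/-- If `e_{(1, 0)} = e_{(0, 1)} = 0` then the Hilbert polynomial and the Hilbert function agree. -/
theorem Filtration.IsAdmissible.binomialPolynomial_eq {F : Filtration I J} (hF : F.IsAdmissible)
    (hR : IsDepthTwo R) (hI : ContainsMaxPow I) (hIm : I ≤ maximalIdeal R)
    (hJ : ContainsMaxPow J) (hJm : J ≤ maximalIdeal R) {e : ℕ × ℕ → ℤ}
    (he : F.IsHilbertCoeff 2 e) (h10 : e (1, 0) = 0) (h01 : e (0, 1) = 0) (r s : ℕ) :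
    binomialPolynomial 2 e r s = F.hilbertFunction r s := by
  have key : ∀ r s : ℕ, F.hilbertFunction r s = e (2, 0) * Ring.choose ((r : ℤ) + 1) 2 +
      e (1, 1) * r * s + e (0, 2) * Ring.choose ((s : ℤ) + 1) 2 := by
    intro r s
    induction r with
    | zero =>
      induction s with
      | zero =>
        have : F.hilbertFunction 0 0 = 0 := by
          change colength (F.ideal 0 0) = 0
          rw [F.ideal_eq_top le_rfl le_rfl, colength_top]
        have h2 : Ring.choose (1 : ℤ) 2 = 0 := by
          have := Ring.choose_natCast (R := ℤ) 1 2
          simpa using this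
        simp [this, h2]
      | succ s ih =>
        have := hF.swap.hilbertFunction_succ hR hJ hJm hI hIm he.swap h01 h10 s 0
        change F.hilbertFunction (0 : ℕ) (s + 1) = F.hilbertFunction (0 : ℕ) s + _ at this
        push_cast at this ih ⊢
        rw [this, ih, choose_add_two_two]
        simp only [Function.comp_apply, Prod.swap_prod_mk]
        ring
    | succ r ih =>
      have := hF.hilbertFunction_succ hR hI hIm hJ hJm he h10 h01 r s
      push_cast at this ih ⊢
      rw [this, ih, choose_add_two_two]
      ring
  obtain ⟨N, hN⟩ := he.2
  -- The formula for H has no constant term, and it equals P at one large point.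
  have h00 : e (0, 0) = 0 := by
    have h1 := hN N.toNat N.toNat (by omega) (by omega)
    rw [key, binomialPolynomial_two, h10, h01] at h1
    linarith
  rw [key, binomialPolynomial_two, h10, h01, h00]
  ring

/-- If `I` is a parameter ideal, `F (r, 0) = I ^ r`, and the Hilbert function is polynomial, then
`e_{(1, 0)} = 0`. -/
theorem Filtration.IsAdmissible.coeff_one_zero_eq_zero {F : Filtration I J} (hF : F.IsAdmissible)
    (hR : IsDepthTwo R) (hd : ringKrullDim R = ((2 : ℕ∞) : WithBot ℕ∞))
    (hI : ContainsMaxPow I) (hIm : I ≤ maximalIdeal R)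
    (hJ : ContainsMaxPow J) (hJm : J ≤ maximalIdeal R) {e : ℕ × ℕ → ℤ}
    (hP : ∀ r : ℕ, binomialPolynomial 2 e r 0 = F.hilbertFunction r 0)
    (hpow : ∀ r : ℕ, F.ideal r 0 = I ^ r) (hpar : IsParameterIdeal I) : e (1, 0) = 0 := by
  obtain ⟨d, x, ⟨hd', -⟩, hIx⟩ := hpar
  obtain rfl : d = 2 := by
    rw [hd] at hd'
    have h : ((2 : ℕ) : ℕ∞) = (d : ℕ∞) := WithBot.coe_injective hd'
    exact_mod_cast h.symm
  -- Nakayama: this lets the superficial element a be chosen outside 𝔪I.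
  have hnot : ¬ I ≤ maximalIdeal R * I := by
    intro hle
    refine hR.depthPos_bot.not_containsMaxPow bot_ne_top (hI.mono ?_)
    refine Submodule.le_of_le_smul_of_le_jacobson_bot (IsNoetherian.noetherian I)
      (IsLocalRing.maximalIdeal_le_jacobson _) ?_
    rw [bot_sup_eq]
    exact hle
  obtain ⟨a, haI, ⟨ha, ⟨N, hN⟩, -⟩, ham⟩ :=
    ((hF.generic_difference hR hI hIm hJ hJm).and (generic_notMem hnot)).exists
  have hxI : ∀ i, x i ∈ I := fun i => hIx ▸ Ideal.subset_span ⟨i, rfl⟩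
  have hI2 : I = Ideal.span {x 0} ⊔ Ideal.span {x 1} := by
    rw [hIx, ← Ideal.span_union]
    congr 1
    ext z
    simp [Fin.exists_fin_two, eq_comm, or_comm]
  -- Writing a = ux₀ + vx₁ with u or v a unit, a replaces the corresponding generator.
  have hex : ∃ y ∈ I, I ≤ Ideal.span {y} ⊔ Ideal.span {a} := by
    have ha2 := haI
    rw [hI2] at ha2
    obtain ⟨p, hp, q, hq, rfl⟩ := Submodule.mem_sup.mp ha2
    obtain ⟨u, rfl⟩ := Ideal.mem_span_singleton'.mp hp
    obtain ⟨v, rfl⟩ := Ideal.mem_span_singleton'.mp hq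
    set b := u * x 0 + v * x 1 with hb
    have hbm : b ∈ Ideal.span {b} := Ideal.mem_span_singleton_self b
    by_cases hu : IsUnit u
    · refine ⟨x 1, hxI 1, hI2.trans_le (sup_le ?_ le_sup_left)⟩
      rw [Ideal.span_singleton_le_iff_mem, ← Ideal.unit_mul_mem_iff_mem _ hu]
      exact Submodule.mem_sup.mpr ⟨-(v * x 1), Submodule.neg_mem _
        (Ideal.mem_span_singleton'.mpr ⟨v, rfl⟩), b, hbm, by rw [hb]; ring⟩
    · by_cases hv : IsUnit v
      · refine ⟨x 0, hxI 0, hI2.trans_le (sup_le le_sup_left ?_)⟩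
        rw [Ideal.span_singleton_le_iff_mem, ← Ideal.unit_mul_mem_iff_mem _ hv]
        exact Submodule.mem_sup.mpr ⟨-(u * x 0), Submodule.neg_mem _
          (Ideal.mem_span_singleton'.mpr ⟨u, rfl⟩), b, hbm, by rw [hb]; ring⟩
      · exact absurd (Ideal.add_mem _ (Ideal.mul_mem_mul ((mem_maximalIdeal u).mpr hu) (hxI 0))
          (Ideal.mul_mem_mul ((mem_maximalIdeal v).mpr hv) (hxI 1))) ham
  obtain ⟨y, hyI, hy⟩ := hex
  have hreg : RegularPair I y a := ⟨hy, fun z hz =>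
    (hR.depthPos_span a (hIm haI) ha).mem_of_mul_mem (hI.mono hy) hz⟩
  -- Superficiality holds for all s, so the difference may be taken along s = 0. Two consecutive
  -- values of r then give e_(2,0) = λ(R/I) and e_(1,0) = 0.
  have hdiff : ∀ r : ℕ, N ≤ r → ((r : ℤ) + 1) * e (2, 0) - e (1, 0) = (r + 1) * colength I := by
    intro r hr
    have h1 := hN r 0 (by exact_mod_cast hr)
    have h2 := hP (r + 1)
    have h3 := hpow (r + 1)
    push_cast at h2 h3
    rw [h3, hreg.colength_pow_sup hI hyI haI, ← h2, ← hP r, binomialPolynomial_two,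
      binomialPolynomial_two, choose_add_two_two] at h1
    push_cast at h1
    linarith
  have h1 := hdiff N le_rfl
  have h2 := hdiff (N + 1) (by omega)
  push_cast at h2
  have h3 : e (2, 0) = colength I := by linarith
  rw [h3] at h1
  linarith

end DimensionTwo

/-! ### Depth conditions from the Cohen–Macaulay property. -/

section CohenMacaulay

open scoped Pointwise

variable {R : Type*} [CommRing R] [IsLocalRing R]

lemma mem_maximalIdeal_of_isRegular {rs : List R} (h : RingTheory.Sequence.IsRegular R rs) {x : R}
    (hx : x ∈ rs) : x ∈ maximalIdeal R := by
  rw [mem_maximalIdeal, mem_nonunits_iff]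
  intro hu
  refine h.top_ne_smul ?_
  have : Ideal.ofList rs = ⊤ := Ideal.eq_top_of_isUnit_mem _ (Ideal.subset_span hx) hu
  rw [this]
  simp

lemma depthPos_bot_of_mem_nonZeroDivisors {x : R} (hx : x ∈ nonZeroDivisors R)
    (hxm : x ∈ maximalIdeal R) : DepthPos (⊥ : Ideal R) := by
  intro z hz
  have := hz x hxm
  rw [Ideal.mem_bot] at this ⊢
  exact (mul_left_mem_nonZeroDivisors_eq_zero_iff hx).mp this

lemma IsCohenMacaulayLocal.depthPos_bot (h : IsCohenMacaulayLocal R) {d : ℕ}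
    (hd : ringKrullDim R = ((d : ℕ∞) : WithBot ℕ∞)) (hd1 : 1 ≤ d) :
    DepthPos (⊥ : Ideal R) := by
  obtain ⟨-, rs, hrs, hlen⟩ := h
  have hl : rs.length = d := by
    rw [hd] at hlen
    exact_mod_cast WithBot.coe_injective hlen
  obtain _ | ⟨x, rs⟩ := rs
  · simp only [List.length_nil] at hl
    omega
  have hx := ((RingTheory.Sequence.isWeaklyRegular_cons_iff R x rs).mp hrs.toIsWeaklyRegular).1
  refine depthPos_bot_of_mem_nonZeroDivisors (x := x) ?_
    (mem_maximalIdeal_of_isRegular hrs (by simp))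
  rw [mem_nonZeroDivisors_iff_left]
  intro z hz
  refine hx ?_
  simpa using hz

/-- A regular sequence x, y shows that R/x has positive depth, and this passes to R/a for every
regular a. -/
lemma IsCohenMacaulayLocal.isDepthTwo (h : IsCohenMacaulayLocal R)
    (hd : ringKrullDim R = ((2 : ℕ∞) : WithBot ℕ∞)) : IsDepthTwo R := by
  have h0 := h.depthPos_bot (d := 2) hd (by norm_num)
  obtain ⟨-, rs, hrs, hlen⟩ := h
  have hl : rs.length = 2 := by
    rw [hd] at hlen
    exact_mod_cast WithBot.coe_injective hlen
  obtain ⟨x, y, rfl⟩ := List.length_eq_two.mp hl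
  have hxm := mem_maximalIdeal_of_isRegular hrs (x := x) (by simp)
  have hym := mem_maximalIdeal_of_isRegular hrs (x := y) (by simp)
  obtain ⟨hx, hy⟩ := (RingTheory.Sequence.isWeaklyRegular_cons_iff R x [y]).mp
    hrs.toIsWeaklyRegular
  have hy := ((RingTheory.Sequence.isWeaklyRegular_cons_iff _ y []).mp hy).1
  have hx0 : x ∈ nonZeroDivisors R := by
    rw [mem_nonZeroDivisors_iff_left]
    intro z hz
    refine hx ?_
    simpa using hz
  have hmem : ∀ z : R, z ∈ x • (⊤ : Submodule R R) ↔ z ∈ Ideal.span {x} := by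
    intro z
    rw [Submodule.mem_smul_pointwise_iff_exists, Ideal.mem_span_singleton']
    simp [mul_comm]
  have hdx : DepthPos (Ideal.span {x}) := by
    intro z hz
    rw [← hmem, ← Submodule.Quotient.mk_eq_zero]
    refine hy ?_
    dsimp only
    rw [smul_zero, ← Submodule.Quotient.mk_smul, Submodule.Quotient.mk_eq_zero, hmem]
    exact hz y hym
  exact ⟨hd.le, h0, fun a _ ha => hdx.of_span_singleton hx0 ha hxm⟩

end CohenMacaulay

/-! ### Assembly of the two cases. -/

section Main

variable {R : Type*} [CommRing R] {I J : Ideal R}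

lemma Filtration.IsAdmissible.ideal_eq_idealZPow {F : Filtration I J} (hF : F.IsAdmissible)
    (h : ∀ r s : ℕ, F.ideal r s = I ^ r * J ^ s) (r s : ℤ) :
    F.ideal r s = idealZPow I r * idealZPow J s := by
  rw [hF.eq_posPart, ← Int.toNat_eq_max, ← Int.toNat_eq_max, h]
  rfl

lemma Filtration.ideal_eq_pow_of_eq_idealZPow {F : Filtration I J}
    (h : ∀ r s : ℤ, F.ideal r s = idealZPow I r * idealZPow J s) (r : ℕ) :
    F.ideal r 0 = I ^ r := by
  simp [h, idealZPow]

lemma Filtration.hilbertFunction_zero_zero (F : Filtration I J) : F.hilbertFunction 0 0 = 0 := by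
  change colength (F.ideal 0 0) = 0
  rw [F.ideal_eq_top le_rfl le_rfl, colength_top]

variable [IsLocalRing R]

lemma isParameterIdeal_span_singleton (hd : ringKrullDim R = ((1 : ℕ∞) : WithBot ℕ∞))
    (hI : IsMaximalPrimary I) {a : R} (h : I = Ideal.span {a}) : IsParameterIdeal I := by
  have hspan : I = Ideal.span (Set.range ![a]) := by simpa using h
  exact ⟨1, ![a], ⟨hd, hspan ▸ hI⟩, hspan⟩

variable [IsNoetherianRing R] [Infinite (ResidueField R)]

theorem Filtration.IsAdmissible.tfae_of_dim_one {F : Filtration I J} (hF : F.IsAdmissible)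
    (hd : ringKrullDim R = ((1 : ℕ∞) : WithBot ℕ∞)) (h0 : DepthPos (⊥ : Ideal R))
    (hI : IsMaximalPrimary I) (hJ : IsMaximalPrimary J) :
    List.TFAE [
      F.hilbertCoeff 1 (1 - 1, 0) = 0 ∧ F.hilbertCoeff 1 (0, 1 - 1) = 0,
      IsParameterIdeal I ∧ IsParameterIdeal J ∧
        (∀ r s : ℕ, F.hilbertPolynomial 1 r s = F.hilbertFunction r s) ∧
        (∀ r s : ℤ, F.ideal r s = idealZPow I r * idealZPow J s),
      ∀ α : ℕ × ℕ, α.1 + α.2 ≤ 1 - 1 → F.hilbertCoeff 1 α = 0] := by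
  obtain ⟨a, haI, b, hbJ, c, N, hH, hc⟩ := hF.exists_hilbertFunction_eq hd.le h0
    (containsMaxPow_of_isMaximalPrimary hI) hI.le_maximalIdeal
    (containsMaxPow_of_isMaximalPrimary hJ) hJ.le_maximalIdeal
  have he := F.isHilbertCoeff_hilbertCoeff (F.exists_isHilbertCoeff_one hH)
  obtain ⟨h10, h01, h00⟩ := he.eq_of_one hH
  tfae_have 3 → 1 := fun h => ⟨h _ (by simp), h _ (by simp)⟩
  tfae_have 1 → 2 := by
    rintro ⟨h, -⟩
    -- For d = 1 both coefficients in the first statement are e_(0,0), the constant c.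
    have hc0 : c = 0 := h00.symm.trans h
    have hIa : I = Ideal.span {a} := by
      refine le_antisymm ?_ ((Ideal.span_singleton_le_iff_mem I).mpr haI)
      have h1 := (hc hc0 1 0).1
      rw [pow_one, pow_zero, mul_one] at h1
      exact h1 ▸ by simpa [idealZPow] using F.pow_le 1 0
    have hJb : J = Ideal.span {b} := by
      refine le_antisymm ?_ ((Ideal.span_singleton_le_iff_mem J).mpr hbJ)
      have h1 := (hc hc0 0 1).1
      rw [pow_one, pow_zero, one_mul] at h1
      exact h1 ▸ by simpa [idealZPow] using F.pow_le 0 1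
    refine ⟨isParameterIdeal_span_singleton hd hI hIa, isParameterIdeal_span_singleton hd hJ hJb,
      fun r s => ?_, hF.ideal_eq_idealZPow fun r s => ?_⟩
    · rw [Filtration.hilbertPolynomial, binomialPolynomial_one, h10, h01, h00, hc0, (hc hc0 r s).2]
      ring
    · rw [(hc hc0 r s).1, ← Ideal.span_singleton_mul_span_singleton, ← Ideal.span_singleton_pow,
        ← Ideal.span_singleton_pow, ← hIa, ← hJb]
  tfae_have 2 → 3 := by
    rintro ⟨-, -, hP, -⟩ ⟨i, j⟩ hα
    obtain ⟨rfl, rfl⟩ : i = 0 ∧ j = 0 := by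
      dsimp only at hα
      omega
    -- At the origin P is -e_(0,0) and H is 0.
    have := hP 0 0
    rw [Filtration.hilbertPolynomial, binomialPolynomial_one, Nat.cast_zero,
      F.hilbertFunction_zero_zero] at this
    linarith
  tfae_finish

theorem Filtration.IsAdmissible.tfae_of_dim_two {F : Filtration I J} (hF : F.IsAdmissible)
    (hd : ringKrullDim R = ((2 : ℕ∞) : WithBot ℕ∞)) (hR : IsDepthTwo R)
    (hI : IsMaximalPrimary I) (hJ : IsMaximalPrimary J) :
    List.TFAE [
      F.hilbertCoeff 2 (2 - 1, 0) = 0 ∧ F.hilbertCoeff 2 (0, 2 - 1) = 0,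
      IsParameterIdeal I ∧ IsParameterIdeal J ∧
        (∀ r s : ℕ, F.hilbertPolynomial 2 r s = F.hilbertFunction r s) ∧
        (∀ r s : ℤ, F.ideal r s = idealZPow I r * idealZPow J s),
      ∀ α : ℕ × ℕ, α.1 + α.2 ≤ 2 - 1 → F.hilbertCoeff 2 α = 0] := by
  have hIc := containsMaxPow_of_isMaximalPrimary hI
  have hIm := hI.le_maximalIdeal
  have hJc := containsMaxPow_of_isMaximalPrimary hJ
  have hJm := hJ.le_maximalIdeal
  have he := F.isHilbertCoeff_hilbertCoeff (hF.exists_isHilbertCoeff_two hR hIc hIm hJc hJm)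
  tfae_have 3 → 1 := fun h => ⟨h _ (by simp), h _ (by simp)⟩
  tfae_have 1 → 2 := by
    rintro ⟨h10, h01⟩
    obtain ⟨a, haI, -, ha⟩ :=
      (hF.generic_isPrincipalModulo hR hIc hIm hJc hJm he h10).exists
    obtain ⟨b, hbJ, -, hb⟩ :=
      (hF.swap.generic_isPrincipalModulo hR hJc hJm hIc hIm he.swap h01).exists
    obtain ⟨x, hxI, hx⟩ := ha.exists_left
    obtain ⟨y, hyJ, hy⟩ := hb.exists_left
    exact ⟨isParameterIdeal_of_le_sup hd hI haI hxI hx, isParameterIdeal_of_le_sup hd hJ hbJ hyJ hy,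
      hF.binomialPolynomial_eq hR hIc hIm hJc hJm he h10 h01,
      hF.ideal_eq_idealZPow (hF.ideal_eq_pow_mul_pow hR hIc hIm hJc hJm he h10 h01)⟩
  tfae_have 2 → 3 := by
    rintro ⟨hIp, hJp, hP, hpow⟩ ⟨i, j⟩ hα
    have h10 := hF.coeff_one_zero_eq_zero hR hd hIc hIm hJc hJm (e := F.hilbertCoeff 2)
      (fun r => hP r 0) (F.ideal_eq_pow_of_eq_idealZPow hpow) hIp
    have h01 := hF.swap.coeff_one_zero_eq_zero hR hd hJc hJm hIc hIm
      (e := F.hilbertCoeff 2 ∘ Prod.swap) (fun r => by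
        refine Eq.trans ?_ (hP 0 r)
        rw [Filtration.hilbertPolynomial, binomialPolynomial_two, binomialPolynomial_two]
        simp only [Function.comp_apply, Prod.swap_prod_mk]
        push_cast
        ring) (F.swap.ideal_eq_pow_of_eq_idealZPow fun r s => (hpow s r).trans (mul_comm _ _)) hJp
    have h00 : F.hilbertCoeff 2 (0, 0) = 0 := by
      have h := hP 0 0
      have h2 : Ring.choose (1 : ℤ) 2 = 0 := by
        have := Ring.choose_natCast (R := ℤ) 1 2
        simpa using this
      rw [Filtration.hilbertPolynomial, binomialPolynomial_two, Nat.cast_zero,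
        F.hilbertFunction_zero_zero, zero_add, h2] at h
      linarith
    dsimp only at hα
    obtain ⟨rfl, rfl⟩ | ⟨rfl, rfl⟩ | ⟨rfl, rfl⟩ :
        (i = 0 ∧ j = 0) ∨ (i = 1 ∧ j = 0) ∨ (i = 0 ∧ j = 1) := by omega
    exacts [h00, h10, h01]
  tfae_finish

end Main

end BigradedHilbert

theorem theorem4p6 {R : Type*} [CommRing R] [IsLocalRing R]
    [Infinite (IsLocalRing.ResidueField R)]
    (hCM : BigradedHilbert.IsCohenMacaulayLocal R)
    (d : ℕ) (hd : ringKrullDim R = ((d : ℕ∞) : WithBot ℕ∞)) (hd1 : 1 ≤ d) (hd2 : d ≤ 2)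
    (I J : Ideal R) (hI : BigradedHilbert.IsMaximalPrimary I)
    (hJ : BigradedHilbert.IsMaximalPrimary J)
    (F : BigradedHilbert.Filtration I J) (hF : F.IsAdmissible) :
    List.TFAE [
      F.hilbertCoeff d (d - 1, 0) = 0 ∧ F.hilbertCoeff d (0, d - 1) = 0,
      BigradedHilbert.IsParameterIdeal I ∧ BigradedHilbert.IsParameterIdeal J ∧
        (∀ r s : ℕ, F.hilbertPolynomial d r s = F.hilbertFunction r s) ∧
        (∀ r s : ℤ, F.ideal r s =
          BigradedHilbert.idealZPow I r * BigradedHilbert.idealZPow J s),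
      ∀ α : ℕ × ℕ, α.1 + α.2 ≤ d - 1 → F.hilbertCoeff d α = 0] := by
  have := hCM.1
  obtain rfl | rfl : d = 1 ∨ d = 2 := by omega
  · exact hF.tfae_of_dim_one hd (hCM.depthPos_bot hd le_rfl) hI hJ
  · exact hF.tfae_of_dim_two hd (hCM.isDepthTwo hd) hI hJ
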